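/- Setting. Let $\Omega$ be a billiard table: the closure of a connected domain of $\mathbb{R}^2$ or of a flat torus, whose boundary is a finite union of simple $C^3$ curves $\Gamma_i$ (walls) with pairwise disjoint interiors, parameterized by arc length $r$ with $\Omega$ on the left. A point interior to a wall is regular, an endpoint of a wall is a corner point. Assume that the table is dispersing (for distinct $x,y\in\Gamma_i$ the open segment from $x$ to $y$ misses $\Omega$, and the curvature at regular points is uniformly bounded away from $0$), that every corner point is simple (at most two ends of walls meet there), that all internal angles at corner points are strictly positive (no cusps), and that the horizon is bounded (straight trajectories between proper collisions, that is, segments contained in $\Omega$, have uniformly bounded length). Let $\mathcal M=\bigsqcup_i\Gamma_i\times[-\pi/2,\pi/2]$ be the collision space with coordinates $(r,\varphi)$, where $\varphi$ is the angle of the outgoing velocity with the inward normal, positive towards the positive tangent vector. Let $F$ be the billiard map (next collision), and let $\mathcal S_0=\partial\mathcal M$ be the set of grazing collisions ($\varphi=\pm\pi/2$) and collisions with corner points; the singularities of $F$ are $\mathcal S_{-1}=F^{-1}\mathcal S_0$. The vertical and horizontal lines through $z\in\mathcal M$ divide the ball $N=N_{z,\rho}\subset\mathcal M$ into open quadrants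 (some may be missing if $z\in\partial\mathcal M$); the NW quadrant ($r$ smaller, $\varphi$ larger) and the SE quadrant ($r$ larger, $\varphi$ smaller) are called active. A sector of order $1$ of a quadrant $Q$ of $N$ is a connected component $C$ of $Q\setminus(\mathcal S_0\cup\mathcal S_{-1})$ with $z\in\overline C$; its image is $C'=F(C)$, with center $z'=\lim_{C\ni w\to z}F(w)$. Fix an integer $k_0\ge1$. The sector $C$ is regular if $z'$ lies in the union $\mathbb H_{-k_0}\cup\mathbb H_0\cup\mathbb H_{k_0}$ of homogeneity strips, that is, the angle $\varphi'$ of $z'$ satisfies $|\varphi'|\le\pi/2-(k_0+1)^{-2}$. Lemma. Let $z\in\mathcal M$. For all sufficiently small $\rho>0$ and every active quadrant $Q$ of $N_{z,\rho}$, there is at most one regular sector $C$ of order $1$ of $Q$ whose image $C'$ contains a (non-empty) active quadrant of some neighborhood of its center $z'$. -/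

import Mathlib

open Set Filter Topology

noncomputable section

namespace Billiard

/-- A boundary curve, drawn in the Euclidean plane `ℂ` and parameterized by arc length. If `isLoop`
holds, the curve is a closed curve of length `len` without endpoints (its parameter runs over `ℝ`
and is understood modulo `len`); otherwise the parameter runs over `[0, len]`. -/
structure Wall where
  len : ℝ
  isLoop : Prop
  curve : ℝ → ℂ

namespace Wall

variable (w : Wall)

/-- The parameters of the curve. -/
def dom : Set ℝ := {r | w.isLoop ∨ r ∈ Icc 0 w.len}

/-- The parameters of the interior of the curve (the curve without its endpoints). -/
def interiorDom : Set ℝ := {r | w.isLoop ∨ r ∈ Ioo 0 w.len}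

/-- The tangent vector in the positive direction (one-sided at an endpoint). -/
def tangent (r : ℝ) : ℂ := derivWithin w.curve w.dom r

/-- The signed curvature with respect to the left normal `I * tangent`. It is positive if the curve
bends away from its left side. -/
def curvature (r : ℝ) : ℝ :=
  -(inner ℝ (Complex.I * w.tangent r) (iteratedDerivWithin 2 w.curve w.dom r) : ℝ)

end Wall

/-- A billiard table in the flat surface `ℂ ⧸ lattice`, where `lattice` is a discrete group of
translations (`⊥` gives the plane, a lattice of rank two gives a flat torus). The table is described
by its preimage `region` in the plane, its walls by one lift each. -/
structure Table where
  lattice : AddSubgroup ℂ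
  discrete : DiscreteTopology lattice
  region : Set ℂ
  numWalls : ℕ
  wall : Fin numWalls → Wall
  region_periodic : ∀ p : ℂ, ∀ l ∈ lattice, (p + l ∈ region ↔ p ∈ region)
  /-- The table is the closure of a connected domain. -/
  region_eq : closure (interior region) = region
  connected : IsConnected
    ((fun p : ℂ => (QuotientAddGroup.mk p : ℂ ⧸ lattice)) '' interior region)
  /-- The boundary is the union of the walls. -/
  frontier_eq : frontier region =
    {p | ∃ i, ∃ r ∈ (wall i).dom, ∃ l ∈ lattice, p = (wall i).curve r + l}
  len_pos : ∀ i, 0 < (wall i).len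
  smooth : ∀ i, ContDiffOn ℝ 3 (wall i).curve (wall i).dom
  unit_speed : ∀ i, ∀ r ∈ (wall i).dom, ‖(wall i).tangent r‖ = 1
  loop_closed : ∀ i, (wall i).isLoop →
    ∃ l ∈ lattice, ∀ r, (wall i).curve (r + (wall i).len) = (wall i).curve r + l
  /-- The walls are simple curves; they can meet each other (or themselves) only at endpoints. -/
  embedded : ∀ i j, ∀ r ∈ (wall i).interiorDom, ∀ s ∈ (wall j).dom,
    (wall i).curve r - (wall j).curve s ∈ lattice →
      i = j ∧ (r = s ∨ ((wall i).isLoop ∧ ∃ k : ℤ, r - s = k * (wall i).len))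
  /-- Walking along a wall in the positive direction, the table lies on the left. -/
  oriented : ∀ i, ∀ r ∈ (wall i).interiorDom, ∀ᶠ ε : ℝ in 𝓝[>] 0,
    (wall i).curve r + ε * (Complex.I * (wall i).tangent r) ∈ interior region

namespace Table

variable (T : Table)

/-- The table is dispersing: every wall is outward convex, and the curvature is uniformly bounded
away from zero. -/
def Dispersing : Prop :=
  (∀ i, ∀ r ∈ (T.wall i).dom, ∀ s ∈ (T.wall i).dom, (T.wall i).curve r ≠ (T.wall i).curve s →
    Disjoint (openSegment ℝ ((T.wall i).curve r) ((T.wall i).curve s)) T.region) ∧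
  ∃ κ₀ : ℝ, 0 < κ₀ ∧ ∀ i, ∀ r ∈ (T.wall i).interiorDom, κ₀ ≤ (T.wall i).curvature r

/-- Every corner point is simple: at most two ends of walls meet at any point. The Boolean selects
the final (`true`) or the initial (`false`) endpoint of a wall. -/
def SimpleCorners : Prop :=
  ∀ p : ℂ, {e : Fin T.numWalls × Bool | ¬ (T.wall e.1).isLoop ∧
    (T.wall e.1).curve (if e.2 then (T.wall e.1).len else 0) - p ∈ T.lattice}.ncard ≤ 2

/-- For the tangent vectors `wm`, `wp` to the boundary before and after a corner point: the angle in
`[0, 2π)` of the sector from `-wm` clockwise to `wp`. -/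
def internalAngle (wm wp : ℂ) : ℝ :=
  toIcoMod Real.two_pi_pos 0 (Complex.arg (-wm / wp))

/-- There are no cusps: the internal angle at every corner point is strictly positive. -/
def NoCusps : Prop :=
  ∀ i j, ¬ (T.wall i).isLoop → ¬ (T.wall j).isLoop →
    (T.wall i).curve (T.wall i).len - (T.wall j).curve 0 ∈ T.lattice →
      0 < internalAngle ((T.wall i).tangent (T.wall i).len) ((T.wall j).tangent 0)

/-- Bounded horizon: straight trajectories between proper collisions are uniformly bounded in
length. A straight trajectory stays in the (closed) table through improper collisions and leaves it
exactly at a proper one, so these trajectories are the maximal segments contained in the table. -/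
def BoundedHorizon : Prop :=
  ∃ τmax : ℝ, ∀ p v : ℂ, ∀ t : ℝ, ‖v‖ = 1 → (∀ s ∈ Icc 0 t, p + s * v ∈ T.region) → t ≤ τmax

/-- The component of the phase space over the wall `i`, in coordinates `(r, φ)`. (For a closed wall
this is the universal cover of the cylinder: `r` is read modulo the length of the wall.) -/
def phase (i : Fin T.numWalls) : Set (ℝ × ℝ) :=
  {z | z.1 ∈ (T.wall i).dom ∧ z.2 ∈ Icc (-(Real.pi / 2)) (Real.pi / 2)}

/-- Grazing collisions and collisions with a corner point: the boundary of the phase space. -/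
def sing (i : Fin T.numWalls) : Set (ℝ × ℝ) :=
  {z | z ∈ T.phase i ∧ (z.1 ∉ (T.wall i).interiorDom ∨ z.2 = Real.pi / 2 ∨ z.2 = -(Real.pi / 2))}

/-- The velocity after the collision `(r, φ)`: at angle `φ` from the inward normal, positive `φ`
meaning rotated towards the positive tangent vector. -/
def outVel (i : Fin T.numWalls) (z : ℝ × ℝ) : ℂ :=
  (T.wall i).tangent z.1 * (Real.sin z.2 + Real.cos z.2 * Complex.I)

/-- The velocity before the collision `(r, φ)`: the mirror image of `outVel` in the tangent line. -/
def inVel (i : Fin T.numWalls) (z : ℝ × ℝ) : ℂ :=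
  (T.wall i).tangent z.1 * (Real.sin z.2 - Real.cos z.2 * Complex.I)

/-- The billiard map `F`: the trajectory leaving the boundary at the phase point `z` over the wall
`i` moves through the interior of the table, and its first collision with the boundary is the phase
point `z'` over the wall `j`. (A relation: the values over the two walls that meet at a corner point
are both allowed.) -/
def Collides (i : Fin T.numWalls) (z : ℝ × ℝ) (j : Fin T.numWalls) (z' : ℝ × ℝ) : Prop :=
  z ∈ T.phase i ∧ z' ∈ T.phase j ∧ ∃ τ : ℝ, 0 < τ ∧ ∃ l ∈ T.lattice,
    (∀ t ∈ Ioo 0 τ, (T.wall i).curve z.1 + t * T.outVel i z ∈ interior T.region) ∧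
    (T.wall i).curve z.1 + τ * T.outVel i z = (T.wall j).curve z'.1 + l ∧
    T.outVel i z = T.inVel j z'

/-- The singularities of the billiard map: the preimage of `sing` under the billiard map. -/
def preSing (i : Fin T.numWalls) : Set (ℝ × ℝ) :=
  {z | ∃ j, ∃ z' ∈ T.sing j, T.Collides i z j z'}

/-- The image of `C` under the billiard map, in the component over the wall `j`. -/
def image (i : Fin T.numWalls) (C : Set (ℝ × ℝ)) (j : Fin T.numWalls) : Set (ℝ × ℝ) :=
  {z' | ∃ z ∈ C, T.Collides i z j z'}

end Table

/-- The four quadrants at a phase point (`r` horizontal, `φ` vertical). -/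
inductive Quadrant
  | NE | NW | SW | SE

/-- The decreasing quadrants are called active. -/
def Quadrant.IsActive (q : Quadrant) : Prop := q = Quadrant.NW ∨ q = Quadrant.SE

/-- The displacement `(a, b)` points into the open quadrant `q`. -/
def Quadrant.Contains (q : Quadrant) (a b : ℝ) : Prop :=
  match q with
  | .NE => 0 < a ∧ 0 < b
  | .NW => a < 0 ∧ 0 < b
  | .SW => a < 0 ∧ b < 0
  | .SE => 0 < a ∧ b < 0

/-- The angles of the regular range: the central homogeneity strip together with its two
neighbours. -/
def regularAngles (k₀ : ℕ) : Set ℝ :=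
  Ico (-(Real.pi / 2) + 1 / ((k₀ : ℝ) + 1) ^ 2) (-(Real.pi / 2) + 1 / (k₀ : ℝ) ^ 2) ∪
  Icc (-(Real.pi / 2) + 1 / (k₀ : ℝ) ^ 2) (Real.pi / 2 - 1 / (k₀ : ℝ) ^ 2) ∪
  Ioc (Real.pi / 2 - 1 / (k₀ : ℝ) ^ 2) (Real.pi / 2 - 1 / ((k₀ : ℝ) + 1) ^ 2)

namespace Table

variable (T : Table)

/-- The open quadrant `q` of the neighborhood of radius `ρ` of `z` in the phase space (possibly
empty if `z` lies on the boundary of the phase space). -/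
def quadrant (i : Fin T.numWalls) (z : ℝ × ℝ) (ρ : ℝ) (q : Quadrant) : Set (ℝ × ℝ) :=
  {w | w ∈ T.phase i ∧ w ∉ T.sing i ∧ (w.1 - z.1) ^ 2 + (w.2 - z.2) ^ 2 < ρ ^ 2 ∧
    q.Contains (w.1 - z.1) (w.2 - z.2)}

/-- `C` is a sector of order one of the quadrant `q` of the `ρ`-neighborhood of `z`: a connected
component of the quadrant minus the singularities, meeting at `z`. -/
def IsSector (i : Fin T.numWalls) (z : ℝ × ℝ) (ρ : ℝ) (q : Quadrant) (C : Set (ℝ × ℝ)) : Prop :=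
  (∃ w ∈ T.quadrant i z ρ q \ T.preSing i,
    C = connectedComponentIn (T.quadrant i z ρ q \ T.preSing i) w) ∧ z ∈ closure C

/-- `z'`, over the wall `j`, is the center of the image of `C`: the limit of the billiard map at `z`
along `C`. -/
def IsCenter (i : Fin T.numWalls) (z : ℝ × ℝ) (C : Set (ℝ × ℝ))
    (j : Fin T.numWalls) (z' : ℝ × ℝ) : Prop :=
  z' ∈ T.phase j ∧ ∀ U ∈ 𝓝 z', ∀ᶠ w in 𝓝[C] z, ∃ w' ∈ U, T.Collides i w j w'

/-- `C` is a regular sector of order one, the center of its image being `z'` over the wall `j`. -/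
def IsRegularSector (k₀ : ℕ) (i : Fin T.numWalls) (z : ℝ × ℝ) (ρ : ℝ) (q : Quadrant)
    (C : Set (ℝ × ℝ)) (j : Fin T.numWalls) (z' : ℝ × ℝ) : Prop :=
  T.IsSector i z ρ q C ∧ T.IsCenter i z C j z' ∧ z'.2 ∈ regularAngles k₀

/-- The set `S`, in the component over the wall `j`, contains an active quadrant of some
neighborhood of `z'`. -/
def ContainsActiveQuadrant (j : Fin T.numWalls) (z' : ℝ × ℝ) (S : Set (ℝ × ℝ)) : Prop :=
  ∃ q : Quadrant, q.IsActive ∧ ∃ ρ : ℝ, 0 < ρ ∧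
    (T.quadrant j z' ρ q).Nonempty ∧ T.quadrant j z' ρ q ⊆ S

end Table

end Billiard

end

/-!
All collisions are described by oriented lines close to the line of `z`. Put `σ = 1` if the quadrant
`Q` is the south-east one and `σ = -1` if it is the north-west one; below, `σ = 1`, and the other case
is its mirror image.

The feet of the trajectories from `Q` lie strictly to the right of the trajectory of `z`, since the
walls are outward convex (`Dispersing.exists_foot_side`). Let `C` be a regular sector whose image
has center `z'`, which the trajectory of `z` reaches after time `t ≥ 0`. As `z'` is not grazing, the
wall is transversal to the trajectory there, and an active quadrant of `z'` contains a whole pencil of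
lines: for a north-west quadrant the lines passing on the right of `z'` at a small distance `a` and
turned to the left by a small angle `b ≥ M * a`, for a south-east quadrant their mirror images
(`exists_hit_in_quadrant`). Collisions near `z'` come from points near `z`
(`exists_localization`, where bounded horizon excludes other lattice translates of the wall), so the
lines of the pencil carry trajectories starting in `C` (`exists_isTransverseTarget`).

If the image of `C` contains a south-east quadrant of `z'`, then these lines lie, at all times before
`t`, to the left of the trajectory of `z`, so their feet are on the wrong side
(`IsTransverseTarget.false_of_neg`). Hence only north-west quadrants occur. Let two such sectors be
given, with times `t₁ ≤ t₂`.

* If `t₁ = t₂`, the two pencils have a line in common. By convexity there is only one phase point near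
  `z` on this line, which then belongs to both sectors, and these are equal
  (`IsTransverseTarget.inter_nonempty`).
* If `t₁ < t₂`, the lines of the second pencil are to the right of the trajectory of `z` at time
  `t₁`, where the wall of the first center extends to the right. So they cross this wall before they
  reach the second center (`IsTransverseTarget.exists_crossing`). For `t₁ > 0` this is impossible. For
  `t₁ = 0`, that is, if `z` lies over a corner point, the trajectories of the second pencil would have
  to start behind the first wall, which convexity of the wall of `z` excludes
  (`IsTransverseTarget.false_of_zero`).
-/

open scoped ComplexConjugate

namespace Billiard

/-! ### Local geometry of a wall -/

namespace Wall

variable {w : Wall}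

theorem dom_eq_univ (h : w.isLoop) : w.dom = univ := by
  ext r; simp [dom, h]

theorem dom_eq_Icc (h : ¬ w.isLoop) : w.dom = Icc 0 w.len := by
  ext r; simp [dom, h]

theorem interiorDom_eq_interior (w : Wall) : w.interiorDom = interior w.dom := by
  by_cases h : w.isLoop
  · rw [dom_eq_univ h]; ext r; simp [interiorDom, h]
  · rw [dom_eq_Icc h, interior_Icc]; ext r; simp [interiorDom, h]

theorem interiorDom_subset_dom (w : Wall) : w.interiorDom ⊆ w.dom := by
  rw [interiorDom_eq_interior]; exact interior_subset

theorem convex_dom (w : Wall) : Convex ℝ w.dom := by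
  by_cases h : w.isLoop
  · rw [dom_eq_univ h]; exact convex_univ
  · rw [dom_eq_Icc h]; exact convex_Icc 0 w.len

theorem isClosed_dom (w : Wall) : IsClosed w.dom := by
  by_cases h : w.isLoop
  · rw [dom_eq_univ h]; exact isClosed_univ
  · rw [dom_eq_Icc h]; exact isClosed_Icc

theorem uniqueDiffOn_dom (hl : 0 < w.len) : UniqueDiffOn ℝ w.dom := by
  by_cases h : w.isLoop
  · rw [dom_eq_univ h]; exact uniqueDiffOn_univ
  · rw [dom_eq_Icc h]; exact uniqueDiffOn_Icc hl

theorem contDiffOn_tangent (hl : 0 < w.len) (hs : ContDiffOn ℝ 3 w.curve w.dom) :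
    ContDiffOn ℝ 2 w.tangent w.dom :=
  hs.derivWithin (uniqueDiffOn_dom hl) (by norm_num)

theorem hasDerivWithinAt_curve (hs : ContDiffOn ℝ 3 w.curve w.dom) {r : ℝ} (hr : r ∈ w.dom) :
    HasDerivWithinAt w.curve (w.tangent r) w.dom r :=
  (hs.differentiableOn (by norm_num) r hr).hasDerivWithinAt

theorem exists_tangent_lipschitz (hl : 0 < w.len) (hs : ContDiffOn ℝ 3 w.curve w.dom) {r₁ : ℝ}
    (hr₁ : r₁ ∈ w.dom) : ∃ K > 0, ∃ δ > 0, ∀ r ∈ w.dom, ∀ r' ∈ w.dom, |r - r₁| < δ → |r' - r₁| < δ →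
      ‖w.tangent r - w.tangent r'‖ ≤ K * |r - r'| := by
  obtain ⟨K, t, ht, hK⟩ := (((contDiffOn_tangent hl hs).of_le (m := 1) (by norm_num)) r₁
    hr₁).exists_lipschitzOnWith w.convex_dom
  obtain ⟨δ, hδ, hball⟩ := Metric.mem_nhdsWithin_iff.1 ht
  refine ⟨K + 1, by positivity, δ, hδ, fun r hr r' hr' h h' => ?_⟩
  have := hK.dist_le_mul r (hball ⟨by simpa [Real.dist_eq] using h, hr⟩) r'
    (hball ⟨by simpa [Real.dist_eq] using h', hr'⟩)
  rw [dist_eq_norm, Real.dist_eq] at this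
  nlinarith [abs_nonneg (r - r')]

/-- Strict differentiability: near `r₁` the wall is uniformly close to its tangent line. -/
theorem exists_strict_deriv (hl : 0 < w.len) (hs : ContDiffOn ℝ 3 w.curve w.dom) {r₁ : ℝ}
    (hr₁ : r₁ ∈ w.dom) {ε : ℝ} (hε : 0 < ε) : ∃ δ > 0, ∀ r ∈ w.dom, ∀ r' ∈ w.dom,
      |r - r₁| < δ → |r' - r₁| < δ →
      ‖w.curve r - w.curve r' - (r - r' : ℝ) * w.tangent r₁‖ ≤ ε * |r - r'| := by
  obtain ⟨δ, hδ, hball⟩ := Metric.continuousOn_iff.1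
    (contDiffOn_tangent hl hs).continuousOn r₁ hr₁ ε hε
  refine ⟨δ, hδ, fun r hr r' hr' h h' => ?_⟩
  have hconv : Convex ℝ (w.dom ∩ Metric.ball r₁ δ) := w.convex_dom.inter (convex_ball _ _)
  have key := hconv.norm_image_sub_le_of_norm_hasDerivWithin_le (𝕜 := ℝ)
    (f := fun s => w.curve s - (s : ℂ) * w.tangent r₁)
    (f' := fun s => w.tangent s - w.tangent r₁) (C := ε) (x := r') (y := r)
    (fun s hs' => by
      have h1 := (hasDerivWithinAt_curve hs hs'.1).mono
        (inter_subset_left (t := Metric.ball r₁ δ))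
      have h2 : HasDerivWithinAt (fun s : ℝ => (s : ℂ) * w.tangent r₁) (w.tangent r₁)
          (w.dom ∩ Metric.ball r₁ δ) s := by
        simpa using ((Complex.ofRealCLM.hasDerivWithinAt (x := s)).mul_const (w.tangent r₁))
      exact h1.sub h2)
    (fun s hs' => by
      have := hball s hs'.1 hs'.2
      rw [dist_eq_norm] at this
      exact this.le)
    ⟨hr', by simpa [Real.dist_eq] using h'⟩ ⟨hr, by simpa [Real.dist_eq] using h⟩
  rw [Real.norm_eq_abs] at key
  calc _ = ‖w.curve r - r * w.tangent r₁ - (w.curve r' - r' * w.tangent r₁)‖ := by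
        congr 1; push_cast; ring
    _ ≤ _ := key

theorem curvature_eq (w : Wall) (r : ℝ) :
    w.curvature r = -(derivWithin w.tangent w.dom r * conj (w.tangent r)).im := by
  have h2 : iteratedDerivWithin 2 w.curve w.dom r = derivWithin w.tangent w.dom r := by
    rw [iteratedDerivWithin_succ]
    refine derivWithin_congr (fun s hs => ?_) ?_
    · rw [iteratedDerivWithin_one]; rfl
    · rw [iteratedDerivWithin_one]; rfl
  rw [curvature, h2, Complex.inner]
  congr 1
  simp [Complex.mul_re, Complex.mul_im]
  ring

/-- A wall with curvature bounded away from zero lies, locally and uniformly, strictly to the right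
of each of its tangent lines. -/
theorem exists_strictly_convex (hl : 0 < w.len) (hs : ContDiffOn ℝ 3 w.curve w.dom)
    {κ : ℝ} (hκ : 0 < κ)
    (hc : ∀ r ∈ w.interiorDom, κ ≤ w.curvature r) {r₁ : ℝ} (hr₁ : r₁ ∈ w.dom) :
    ∃ δ > 0, ∀ r₀ ∈ w.dom, ∀ r ∈ w.dom, |r₀ - r₁| < δ → |r - r₁| < δ → r ≠ r₀ →
      ((w.curve r - w.curve r₀) * conj (w.tangent r₀)).im < 0 := by
  have hT := contDiffOn_tangent hl hs
  obtain ⟨K, hK, δ₁, hδ₁, hlip⟩ := exists_tangent_lipschitz hl hs hr₁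
  -- a bound for the second derivative near `r₁`
  have hcont2 : ContinuousOn (derivWithin w.tangent w.dom) w.dom :=
    (hT.derivWithin (m := 1) (uniqueDiffOn_dom hl) (by norm_num)).continuousOn
  obtain ⟨δ₂, hδ₂, hb⟩ := Metric.continuousOn_iff.1 hcont2 r₁ hr₁ 1 one_pos
  set B : ℝ := ‖derivWithin w.tangent w.dom r₁‖ + 1 with hB
  have hBpos : 0 < B := by positivity
  set δ := min (min δ₁ δ₂) (κ / (4 * B * K)) with hδ
  have hδpos : 0 < δ := by positivity
  refine ⟨δ, hδpos, fun r₀ hr₀ r hr h₀ h hne => ?_⟩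
  have hconv : Convex ℝ (w.dom ∩ Metric.ball r₁ δ) := w.convex_dom.inter (convex_ball _ _)
  have hr₀' : r₀ ∈ w.dom ∩ Metric.ball r₁ δ := ⟨hr₀, by simpa [Real.dist_eq] using h₀⟩
  have hr' : r ∈ w.dom ∩ Metric.ball r₁ δ := ⟨hr, by simpa [Real.dist_eq] using h⟩
  set L : ℂ →L[ℝ] ℝ := Complex.imCLM.comp
    ((ContinuousLinearMap.mul ℝ ℂ).flip (conj (w.tangent r₀))) with hL
  have hLapp : ∀ q, L q = (q * conj (w.tangent r₀)).im := fun q => by simp [hL]; ring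
  have hint : interior (w.dom ∩ Metric.ball r₁ δ) = w.interiorDom ∩ Metric.ball r₁ δ := by
    rw [interior_inter, interior_eq_iff_isOpen.2 Metric.isOpen_ball, interiorDom_eq_interior]
  -- the normal component of the tangent has derivative close to minus the curvature
  have hanti : StrictAntiOn (fun s => L (w.tangent s)) (w.dom ∩ Metric.ball r₁ δ) := by
    refine strictAntiOn_of_deriv_neg hconv
      ((L.continuous.comp_continuousOn hT.continuousOn).mono inter_subset_left) fun s hs' => ?_
    rw [hint] at hs'
    have hsd : s ∈ w.dom := w.interiorDom_subset_dom hs'.1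
    have hsi : w.dom ∈ 𝓝 s := mem_interior_iff_mem_nhds.1 (w.interiorDom_eq_interior ▸ hs'.1)
    have hd : HasDerivAt w.tangent (derivWithin w.tangent w.dom s) s :=
      ((hT.differentiableOn (by norm_num)) s hsd).hasDerivWithinAt.hasDerivAt hsi
    have hdL : HasDerivAt (fun s => L (w.tangent s)) (L (derivWithin w.tangent w.dom s)) s :=
      L.hasFDerivAt.comp_hasDerivAt s hd
    rw [hdL.deriv, hLapp]
    have hcs := hc s hs'.1
    rw [curvature_eq] at hcs
    have hsδ : |s - r₁| < δ := by simpa [Real.dist_eq] using hs'.2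
    have hTs : ‖w.tangent r₀ - w.tangent s‖ ≤ K * |r₀ - s| := hlip r₀ hr₀ s hsd
      (h₀.trans_le ((min_le_left _ _).trans (min_le_left _ _)))
      (hsδ.trans_le ((min_le_left _ _).trans (min_le_left _ _)))
    have hBs : ‖derivWithin w.tangent w.dom s‖ ≤ B := by
      have := hb s hsd ((Real.dist_eq s r₁).trans_lt
        (hsδ.trans_le ((min_le_left _ _).trans (min_le_right _ _))))
      rw [dist_eq_norm] at this
      have h3 := norm_sub_norm_le (derivWithin w.tangent w.dom s) (derivWithin w.tangent w.dom r₁)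
      linarith
    have hdist : |r₀ - s| < κ / (2 * B * K) := by
      have h4 : δ ≤ κ / (4 * B * K) := min_le_right _ _
      have h5 : |r₀ - s| ≤ |r₀ - r₁| + |s - r₁| := by
        rw [abs_sub_comm s r₁]; exact abs_sub_le _ _ _
      have h6 : κ / (2 * B * K) = κ / (4 * B * K) + κ / (4 * B * K) := by field_simp; norm_num
      linarith
    have herr : |(derivWithin w.tangent w.dom s * conj (w.tangent r₀ - w.tangent s)).im| < κ := by
      refine (Complex.abs_im_le_norm _).trans_lt ?_
      rw [norm_mul, Complex.norm_conj]
      calc ‖derivWithin w.tangent w.dom s‖ * ‖w.tangent r₀ - w.tangent s‖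
          ≤ B * (K * |r₀ - s|) := by gcongr
        _ ≤ B * (K * (κ / (2 * B * K))) := by gcongr
        _ = κ / 2 := by field_simp
        _ < κ := by linarith
    have hsplit : (derivWithin w.tangent w.dom s * conj (w.tangent r₀)).im =
        (derivWithin w.tangent w.dom s * conj (w.tangent s)).im +
        (derivWithin w.tangent w.dom s * conj (w.tangent r₀ - w.tangent s)).im := by
      rw [← Complex.add_im, ← mul_add, ← map_add]; congr 3; ring
    rw [hsplit]
    have := (abs_lt.1 herr).2
    linarith
  have hzero : L (w.tangent r₀) = 0 := by
    rw [hLapp, Complex.mul_conj]; exact Complex.ofReal_im _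
  have hderiv : ∀ s ∈ w.interiorDom, HasDerivAt (fun s => L (w.curve s)) (L (w.tangent s)) s := by
    intro s hs'
    have hsd : s ∈ w.dom := w.interiorDom_subset_dom hs'
    have hsi : w.dom ∈ 𝓝 s := mem_interior_iff_mem_nhds.1 (w.interiorDom_eq_interior ▸ hs')
    exact L.hasFDerivAt.comp_hasDerivAt s ((hasDerivWithinAt_curve hs hsd).hasDerivAt hsi)
  have hcontL : ContinuousOn (fun s => L (w.curve s)) w.dom :=
    L.continuous.comp_continuousOn hs.continuousOn
  have hsub : ∀ a ∈ w.dom ∩ Metric.ball r₁ δ, ∀ b ∈ w.dom ∩ Metric.ball r₁ δ,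
      Icc a b ⊆ w.dom ∩ Metric.ball r₁ δ := fun a ha b hb => hconv.ordConnected.out ha hb
  have hIoo : ∀ a ∈ w.dom ∩ Metric.ball r₁ δ, ∀ b ∈ w.dom ∩ Metric.ball r₁ δ,
      ∀ s ∈ Ioo a b, s ∈ w.interiorDom := fun a ha b hb s hs' => by
    rw [interiorDom_eq_interior]
    exact interior_mono ((hsub a ha b hb).trans inter_subset_left) (by rwa [interior_Icc])
  rw [sub_mul, Complex.sub_im, ← hLapp, ← hLapp, sub_neg]
  rcases lt_or_gt_of_ne hne with hlt | hgt
  · refine strictMonoOn_of_deriv_pos (convex_Icc r r₀)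
      (hcontL.mono ((hsub r hr' r₀ hr₀').trans inter_subset_left)) (fun s hs' => ?_)
      (left_mem_Icc.2 hlt.le) (right_mem_Icc.2 hlt.le) hlt
    rw [interior_Icc] at hs'
    rw [(hderiv s (hIoo r hr' r₀ hr₀' s hs')).deriv, ← hzero]
    exact hanti (hsub r hr' r₀ hr₀' (Ioo_subset_Icc_self hs')) hr₀' hs'.2
  · refine strictAntiOn_of_deriv_neg (convex_Icc r₀ r)
      (hcontL.mono ((hsub r₀ hr₀' r hr').trans inter_subset_left)) (fun s hs' => ?_)
      (left_mem_Icc.2 hgt.le) (right_mem_Icc.2 hgt.le) hgt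
    rw [interior_Icc] at hs'
    rw [(hderiv s (hIoo r₀ hr₀' r hr' s hs')).deriv, ← hzero]
    exact hanti hr₀' (hsub r₀ hr₀' r hr' (Ioo_subset_Icc_self hs')) hs'.1

end Wall

/-! ### Outgoing trajectories near a phase point -/

namespace Table

variable {T : Table}

theorem norm_tangent {i : Fin T.numWalls} {r : ℝ} (hr : r ∈ (T.wall i).dom) :
    ‖(T.wall i).tangent r‖ = 1 := T.unit_speed i r hr

theorem tangent_mul_conj {i : Fin T.numWalls} {r : ℝ} (hr : r ∈ (T.wall i).dom) :
    (T.wall i).tangent r * conj ((T.wall i).tangent r) = 1 := by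
  rw [Complex.mul_conj, Complex.normSq_eq_norm_sq, norm_tangent hr]; simp

theorem outVel_mul_conj_tangent {i : Fin T.numWalls} {z : ℝ × ℝ} (hz : z ∈ T.phase i) :
    T.outVel i z * conj ((T.wall i).tangent z.1) = Real.sin z.2 + Real.cos z.2 * Complex.I := by
  rw [outVel, mul_right_comm, tangent_mul_conj hz.1, one_mul]

theorem norm_outVel {i : Fin T.numWalls} {z : ℝ × ℝ} (hz : z ∈ T.phase i) :
    ‖T.outVel i z‖ = 1 := by
  rw [outVel, norm_mul, norm_tangent hz.1, one_mul, ← sq_eq_sq₀ (norm_nonneg _) zero_le_one,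
    ← Complex.normSq_eq_norm_sq, Complex.normSq_add_mul_I]
  simp

theorem cos_nonneg_of_mem_phase {i : Fin T.numWalls} {z : ℝ × ℝ} (hz : z ∈ T.phase i) :
    0 ≤ Real.cos z.2 := Real.cos_nonneg_of_mem_Icc hz.2

theorem isClosed_phase (T : Table) (i : Fin T.numWalls) : IsClosed (T.phase i) :=
  ((T.wall i).isClosed_dom.preimage continuous_fst).inter (isClosed_Icc.preimage continuous_snd)

theorem continuousOn_tangent (T : Table) (i : Fin T.numWalls) :
    ContinuousOn (T.wall i).tangent (T.wall i).dom :=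
  (Wall.contDiffOn_tangent (T.len_pos i) (T.smooth i)).continuousOn

theorem continuousOn_curve_fst (T : Table) (i : Fin T.numWalls) :
    ContinuousOn (fun z : ℝ × ℝ => (T.wall i).curve z.1) (T.phase i) :=
  (T.smooth i).continuousOn.comp continuousOn_fst fun _ hz => hz.1

theorem continuousOn_outVel (T : Table) (i : Fin T.numWalls) :
    ContinuousOn (T.outVel i) (T.phase i) := by
  have h : ContinuousOn (fun z : ℝ × ℝ => (T.wall i).tangent z.1) (T.phase i) :=
    (T.continuousOn_tangent i).comp continuousOn_fst fun _ hz => hz.1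
  exact h.mul (by fun_prop)

theorem continuousOn_inVel (T : Table) (i : Fin T.numWalls) :
    ContinuousOn (T.inVel i) (T.phase i) := by
  have h : ContinuousOn (fun z : ℝ × ℝ => (T.wall i).tangent z.1) (T.phase i) :=
    (T.continuousOn_tangent i).comp continuousOn_fst fun _ hz => hz.1
  exact h.mul (by fun_prop)

theorem isClosed_region (T : Table) : IsClosed T.region := by
  rw [← T.region_eq]; exact isClosed_closure

theorem wall_add_notMem_interior (T : Table) {j : Fin T.numWalls} {r : ℝ}
    (hr : r ∈ (T.wall j).dom) {l : ℂ} (hl : l ∈ T.lattice) :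
    (T.wall j).curve r + l ∉ interior T.region := by
  have : (T.wall j).curve r + l ∈ frontier T.region := by
    rw [T.frontier_eq]; exact ⟨j, r, hr, l, hl, rfl⟩
  exact this.2

/-- Near `r₁` the wall lies, uniformly, strictly to the right of each of its tangent lines. -/
theorem Dispersing.exists_strictly_convex (h : T.Dispersing) {i : Fin T.numWalls} {r₁ : ℝ}
    (hr₁ : r₁ ∈ (T.wall i).dom) : ∃ δ > 0, ∀ r₀ ∈ (T.wall i).dom, ∀ r ∈ (T.wall i).dom,
      |r₀ - r₁| < δ → |r - r₁| < δ → r ≠ r₀ →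
      (((T.wall i).curve r - (T.wall i).curve r₀) * conj ((T.wall i).tangent r₀)).im < 0 := by
  obtain ⟨κ, hκ, hc⟩ := h.2
  exact Wall.exists_strictly_convex (T.len_pos i) (T.smooth i) hκ (hc i) hr₁

/-- Locally, an outgoing trajectory does not return to the wall that it leaves. -/
theorem Dispersing.exists_no_return (h : T.Dispersing) {i : Fin T.numWalls} {z : ℝ × ℝ}
    (hz : z ∈ T.phase i) : ∃ δ > 0, ∀ w₁ ∈ T.phase i, ∀ w₂ ∈ T.phase i,
      dist w₁ z < δ → dist w₂ z < δ → ∀ c : ℝ, 0 < c →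
      (T.wall i).curve w₂.1 ≠ (T.wall i).curve w₁.1 + c * T.outVel i w₁ := by
  obtain ⟨δ, hδ, hconv⟩ := h.exists_strictly_convex hz.1
  refine ⟨δ, hδ, fun w₁ h₁ w₂ h₂ hd₁ hd₂ c hc heq => ?_⟩
  have hΔ : (T.wall i).curve w₂.1 - (T.wall i).curve w₁.1 = c * T.outVel i w₁ := by
    rw [heq]; ring
  have hd₁' : |w₁.1 - z.1| < δ := (le_max_left _ _).trans_lt hd₁
  have hd₂' : |w₂.1 - z.1| < δ := (le_max_left _ _).trans_lt hd₂
  by_cases hr : w₂.1 = w₁.1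
  · rw [hr, sub_self] at hΔ
    have := congrArg norm hΔ
    rw [norm_mul, norm_outVel h₁, norm_zero, Complex.norm_real, Real.norm_eq_abs,
      abs_of_pos hc] at this
    linarith
  · have := hconv _ h₁.1 _ h₂.1 hd₁' hd₂' hr
    rw [hΔ, mul_assoc, outVel_mul_conj_tangent h₁, Complex.im_ofReal_mul] at this
    have hcos := cos_nonneg_of_mem_phase h₁
    have h3 : ((Real.sin w₁.2 : ℂ) + Real.cos w₁.2 * Complex.I).im = Real.cos w₁.2 := by
      rw [Complex.add_im, Complex.ofReal_im, Complex.im_ofReal_mul, Complex.I_im, mul_one, zero_add]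
    rw [h3] at this
    nlinarith

/-- Locally, an outgoing phase point is determined by its oriented line. -/
theorem Dispersing.exists_injective_line (h : T.Dispersing) {i : Fin T.numWalls} {z : ℝ × ℝ}
    (hz : z ∈ T.phase i) : ∃ δ > 0, ∀ w₁ ∈ T.phase i, ∀ w₂ ∈ T.phase i,
      dist w₁ z < δ → dist w₂ z < δ → T.outVel i w₁ = T.outVel i w₂ → ∀ c : ℝ,
      (T.wall i).curve w₂.1 = (T.wall i).curve w₁.1 + c * T.outVel i w₁ → w₁ = w₂ := by
  obtain ⟨δ₁, hδ₁, hconv⟩ := h.exists_strictly_convex hz.1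
  obtain ⟨δ₂, hδ₂, hno⟩ := h.exists_no_return hz
  refine ⟨min δ₁ δ₂, by positivity, fun w₁ h₁ w₂ h₂ hd₁ hd₂ hv c heq => ?_⟩
  have hd₁' : |w₁.1 - z.1| < δ₁ := (le_max_left _ _).trans_lt (hd₁.trans_le (min_le_left _ _))
  have hd₂' : |w₂.1 - z.1| < δ₁ := (le_max_left _ _).trans_lt (hd₂.trans_le (min_le_left _ _))
  have hd₁'' := hd₁.trans_le (min_le_right _ _)
  have hd₂'' := hd₂.trans_le (min_le_right _ _)
  rcases lt_trichotomy c 0 with hc | hc | hc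
  · refine (hno w₂ h₂ w₁ h₁ hd₂'' hd₁'' (-c) (by linarith) ?_).elim
    rw [heq, ← hv]; push_cast; ring
  · have hr : w₂.1 = w₁.1 := by
      by_contra hr
      have := hconv _ h₁.1 _ h₂.1 hd₁' hd₂' hr
      simp [heq, hc] at this
    have h3 : (Real.sin w₁.2 : ℂ) + Real.cos w₁.2 * Complex.I =
        Real.sin w₂.2 + Real.cos w₂.2 * Complex.I := by
      rw [← outVel_mul_conj_tangent h₁, ← outVel_mul_conj_tangent h₂, hv, hr]
    have h4 : Real.sin w₁.2 = Real.sin w₂.2 := by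
      have := congrArg Complex.re h3
      simpa only [Complex.add_re, Complex.ofReal_re, Complex.re_ofReal_mul, Complex.I_re, mul_zero,
        add_zero] using this
    exact Prod.ext hr.symm (Real.injOn_sin h₁.2 h₂.2 h4)
  · exact (hno w₁ h₁ w₂ h₂ hd₁'' hd₂'' c hc heq).elim

/-- The feet of the trajectories in the active quadrant of sign `σ` at `z` (`σ = 1` for the
south-east, `σ = -1` for the north-west quadrant) lie strictly on one side of the trajectory of
`z`: on its right for `σ = 1`, on its left for `σ = -1`. At a grazing `z` this is the convexity of
the wall, and only one of the two quadrants exists. -/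
theorem Dispersing.exists_foot_side (h : T.Dispersing) {i : Fin T.numWalls} {z : ℝ × ℝ}
    (hz : z ∈ T.phase i) {σ : ℝ} (hσ : σ = 1 ∨ σ = -1) : ∃ δ > 0, ∀ w ∈ T.phase i,
      dist w z < δ → 0 < σ * (w.1 - z.1) → σ * (w.2 - z.2) < 0 →
      σ * (((T.wall i).curve w.1 - (T.wall i).curve z.1) * conj (T.outVel i z)).im < 0 := by
  have hsig : |σ| = 1 := by rcases hσ with rfl | rfl <;> simp
  rcases (cos_nonneg_of_mem_phase hz).eq_or_lt with hcos | hcos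
  · obtain ⟨δ, hδ, hconv⟩ := h.exists_strictly_convex hz.1
    refine ⟨δ, hδ, fun w hw hd h1 h2 => ?_⟩
    have hne : w.1 ≠ z.1 := by
      intro h; rw [h, sub_self, mul_zero] at h1; exact lt_irrefl _ h1
    have hlt := hconv _ hz.1 _ hw.1 (by simpa using hδ) ((le_max_left _ _).trans_lt hd) hne
    have hphi : z.2 = Real.pi / 2 ∨ z.2 = -(Real.pi / 2) := by
      by_contra hcon
      push Not at hcon
      have := Real.cos_pos_of_mem_Ioo ⟨lt_of_le_of_ne hz.2.1 (Ne.symm hcon.2),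
        lt_of_le_of_ne hz.2.2 hcon.1⟩
      linarith
    rcases hphi with hphi | hphi
    · have hv : T.outVel i z = (T.wall i).tangent z.1 := by simp [outVel, hphi]
      have hw2 := hw.2.2
      rcases hσ with rfl | rfl
      · rw [hv]; linarith
      · linarith
    · have hv : T.outVel i z = -(T.wall i).tangent z.1 := by simp [outVel, hphi]
      have hw2 := hw.2.1
      rcases hσ with rfl | rfl
      · linarith
      · rw [hv, map_neg, mul_neg, Complex.neg_im]; linarith
  · obtain ⟨δ, hδ, hst⟩ := Wall.exists_strict_deriv (T.len_pos i) (T.smooth i) hz.1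
      (half_pos hcos)
    refine ⟨δ, hδ, fun w hw hd h1 _ => ?_⟩
    have hlt := hst _ hw.1 _ hz.1 ((le_max_left _ _).trans_lt hd) (by simpa using hδ)
    set E := (T.wall i).curve w.1 - (T.wall i).curve z.1
      - (w.1 - z.1 : ℝ) * (T.wall i).tangent z.1 with hE
    have hTv : ((T.wall i).tangent z.1 * conj (T.outVel i z)).im = -Real.cos z.2 := by
      have h5 := congrArg conj (outVel_mul_conj_tangent hz)
      rw [map_mul, Complex.conj_conj, mul_comm] at h5
      rw [h5, Complex.conj_im, Complex.add_im, Complex.ofReal_im, Complex.im_ofReal_mul,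
        Complex.I_im, mul_one, zero_add]
    have hsplit : (((T.wall i).curve w.1 - (T.wall i).curve z.1) * conj (T.outVel i z)).im =
        (E * conj (T.outVel i z)).im - (w.1 - z.1) * Real.cos z.2 := by
      have : (T.wall i).curve w.1 - (T.wall i).curve z.1 =
        E + (w.1 - z.1 : ℝ) * (T.wall i).tangent z.1 := by rw [hE]; ring
      rw [this, add_mul, Complex.add_im, mul_assoc, Complex.im_ofReal_mul, hTv]; ring
    have hEb : |σ * (E * conj (T.outVel i z)).im| ≤ Real.cos z.2 / 2 * |w.1 - z.1| := by
      rw [abs_mul, hsig, one_mul]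
      refine (Complex.abs_im_le_norm _).trans ?_
      rw [norm_mul, Complex.norm_conj, norm_outVel hz, mul_one]
      exact hlt
    have habs : |w.1 - z.1| = σ * (w.1 - z.1) := by
      rw [← abs_of_pos h1, abs_mul, hsig, one_mul]
    rw [habs] at hEb
    rw [hsplit]
    have := (abs_le.1 hEb).2
    nlinarith

/-! ### Limits of collisions -/

/-- The closure of the billiard relation: the phase point `z'` over the wall `j`, translated by the
lattice vector `l`, is reached from the phase point `z` over the wall `i` in time `τ ≥ 0` by a
trajectory that stays in the (closed) table, and may pass through improper collisions. -/
structure ClosedCollision (T : Table) (i : Fin T.numWalls) (z : ℝ × ℝ) (j : Fin T.numWalls)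
    (z' : ℝ × ℝ) (τ : ℝ) (l : ℂ) : Prop where
  mem_left : z ∈ T.phase i
  mem_right : z' ∈ T.phase j
  nonneg : 0 ≤ τ
  mem_lattice : l ∈ T.lattice
  mem_region : ∀ t ∈ Icc 0 τ, (T.wall i).curve z.1 + t * T.outVel i z ∈ T.region
  endpoint : (T.wall i).curve z.1 + τ * T.outVel i z = (T.wall j).curve z'.1 + l
  vel : T.outVel i z = T.inVel j z'

theorem Collides.exists_closedCollision {i j : Fin T.numWalls} {z z' : ℝ × ℝ}
    (h : T.Collides i z j z') : ∃ τ l, 0 < τ ∧ T.ClosedCollision i z j z' τ l ∧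
      ∀ t ∈ Ioo 0 τ, (T.wall i).curve z.1 + t * T.outVel i z ∈ interior T.region := by
  obtain ⟨h1, h2, τ, hτ, l, hl, h3, h4, h5⟩ := h
  refine ⟨τ, l, hτ, ⟨h1, h2, hτ.le, hl, fun t ht => ?_, h4, h5⟩, h3⟩
  have hcl : Icc 0 τ ⊆ (fun t : ℝ => (T.wall i).curve z.1 + t * T.outVel i z) ⁻¹' T.region := by
    rw [← closure_Ioo hτ.ne]
    exact closure_minimal (fun s hs => show _ ∈ T.region from interior_subset (h3 s hs))
      (T.isClosed_region.preimage (by fun_prop))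
  exact hcl ht

theorem ClosedCollision.le_of_horizon {i j : Fin T.numWalls} {z z' : ℝ × ℝ} {τ : ℝ} {l : ℂ}
    (h : T.ClosedCollision i z j z' τ l) {τmax : ℝ}
    (hmax : ∀ p v : ℂ, ∀ t : ℝ, ‖v‖ = 1 → (∀ s ∈ Icc 0 t, p + s * v ∈ T.region) → t ≤ τmax) :
    τ ≤ τmax := hmax _ _ _ (norm_outVel h.mem_left) h.mem_region

/-- The lattice being discrete, convergent sequences in it are eventually constant. -/
theorem exists_eventually_const {l : ℕ → ℂ} {L : ℂ} (hl : ∀ n, l n ∈ T.lattice)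
    (hL : Tendsto l atTop (𝓝 L)) : L ∈ T.lattice ∧ ∀ᶠ n in atTop, l n = L := by
  have := T.discrete
  have hLm : L ∈ T.lattice := (AddSubgroup.isClosed_of_discrete (H := T.lattice)).mem_of_tendsto hL
    (Eventually.of_forall hl)
  refine ⟨hLm, ?_⟩
  have h1 : Tendsto (fun n => (⟨l n, hl n⟩ : T.lattice)) atTop (𝓝 ⟨L, hLm⟩) :=
    tendsto_subtype_rng.2 hL
  rw [nhds_discrete, tendsto_pure] at h1
  filter_upwards [h1] with n hn
  exact congrArg Subtype.val hn

/-- With bounded horizon, closed collisions form a closed relation with compact fibers. -/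
theorem exists_subseq_closedCollision {i j : Fin T.numWalls} {τmax : ℝ}
    (hmax : ∀ p v : ℂ, ∀ t : ℝ, ‖v‖ = 1 → (∀ s ∈ Icc 0 t, p + s * v ∈ T.region) → t ≤ τmax)
    {z z' : ℕ → ℝ × ℝ} {τ : ℕ → ℝ} {l : ℕ → ℂ}
    (hc : ∀ n, T.ClosedCollision i (z n) j (z' n) (τ n) (l n))
    (hb : Bornology.IsBounded (range z)) {y' : ℝ × ℝ} (hy' : Tendsto z' atTop (𝓝 y')) :
    ∃ (y : ℝ × ℝ) (t : ℝ) (m : ℂ) (ψ : ℕ → ℕ), StrictMono ψ ∧ Tendsto (z ∘ ψ) atTop (𝓝 y) ∧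
      Tendsto (τ ∘ ψ) atTop (𝓝 t) ∧ (∀ᶠ n in atTop, l (ψ n) = m) ∧
      T.ClosedCollision i y j y' t m := by
  obtain ⟨y, -, φ, hφ, hy⟩ := tendsto_subseq_of_bounded hb (fun n => mem_range_self n)
  have hτb : ∀ n, (τ ∘ φ) n ∈ Icc 0 τmax := fun n =>
    ⟨(hc (φ n)).nonneg, (hc (φ n)).le_of_horizon hmax⟩
  obtain ⟨t, ht, χ, hχ, hτ⟩ := isCompact_Icc.tendsto_subseq hτb
  have hy2 : Tendsto (fun n => z (φ (χ n))) atTop (𝓝 y) := hy.comp hχ.tendsto_atTop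
  have hy2' : Tendsto (fun n => z' (φ (χ n))) atTop (𝓝 y') :=
    hy'.comp (hφ.tendsto_atTop.comp hχ.tendsto_atTop)
  have hτ2 : Tendsto (fun n => τ (φ (χ n))) atTop (𝓝 t) := hτ
  have hyp : y ∈ T.phase i := (T.isClosed_phase i).mem_of_tendsto hy2
    (Eventually.of_forall fun n => (hc _).mem_left)
  have hyp' : y' ∈ T.phase j := (T.isClosed_phase j).mem_of_tendsto hy2'
    (Eventually.of_forall fun n => (hc _).mem_right)
  have hw : Tendsto (fun n => z (φ (χ n))) atTop (𝓝[T.phase i] y) :=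
    tendsto_nhdsWithin_iff.2 ⟨hy2, Eventually.of_forall fun n => (hc _).mem_left⟩
  have hw' : Tendsto (fun n => z' (φ (χ n))) atTop (𝓝[T.phase j] y') :=
    tendsto_nhdsWithin_iff.2 ⟨hy2', Eventually.of_forall fun n => (hc _).mem_right⟩
  have hcur := (T.continuousOn_curve_fst i y hyp).tendsto.comp hw
  have hvel := (T.continuousOn_outVel i y hyp).tendsto.comp hw
  have hcur' := (T.continuousOn_curve_fst j y' hyp').tendsto.comp hw'
  have hvel' := (T.continuousOn_inVel j y' hyp').tendsto.comp hw'
  have hτC : Tendsto (fun n => (τ (φ (χ n)) : ℂ)) atTop (𝓝 (t : ℂ)) :=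
    (Complex.continuous_ofReal.tendsto t).comp hτ2
  have hl := (hcur.add (hτC.mul hvel)).sub hcur'
  have hleq : ∀ n, ((fun z : ℝ × ℝ => (T.wall i).curve z.1) ∘ fun n => z (φ (χ n))) n +
      (τ (φ (χ n)) : ℂ) * (T.outVel i ∘ fun n => z (φ (χ n))) n -
      ((fun z : ℝ × ℝ => (T.wall j).curve z.1) ∘ fun n => z' (φ (χ n))) n = l (φ (χ n)) := by
    intro n
    have := (hc (φ (χ n))).endpoint
    simp only [Function.comp_apply]
    rw [this]; ring
  rw [tendsto_congr hleq] at hl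
  obtain ⟨hm, hev⟩ := exists_eventually_const (fun n => (hc (φ (χ n))).mem_lattice) hl
  refine ⟨y, t, _, φ ∘ χ, hφ.comp hχ, hy2, hτ2, hev, hyp, hyp', ht.1, hm, fun s hs => ?_,
    by ring, tendsto_nhds_unique (hvel.congr fun n => (hc (φ (χ n))).vel) hvel'⟩
  have hmin : Tendsto (fun n => (min s (τ (φ (χ n))) : ℝ)) atTop (𝓝 s) := by
    have := (tendsto_const_nhds (x := s)).min hτ2
    rwa [min_eq_left hs.2] at this
  have hminC : Tendsto (fun n => ((min s (τ (φ (χ n))) : ℝ) : ℂ)) atTop (𝓝 (s : ℂ)) :=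
    (Complex.continuous_ofReal.tendsto s).comp hmin
  exact T.isClosed_region.mem_of_tendsto (hcur.add (hminC.mul hvel))
    (Eventually.of_forall fun n => (hc (φ (χ n))).mem_region _
      ⟨le_min hs.1 (hc _).nonneg, min_le_right _ _⟩)

/-- A segment contained in the table whose displacement is a lattice vector would extend to a ray in
the table. -/
theorem BoundedHorizon.no_periodic_segment (h : T.BoundedHorizon) {p v : ℂ} (hv : ‖v‖ = 1) {s : ℝ}
    (hs : 0 < s) (hseg : ∀ t ∈ Icc 0 s, p + t * v ∈ T.region) (hper : s * v ∈ T.lattice) :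
    False := by
  obtain ⟨τmax, hmax⟩ := h
  have := hmax p v (τmax + 1) hv fun t _ => by
    have h1 : p + t * v = (p + (t - ⌊t / s⌋ * s : ℝ) * v) + ⌊t / s⌋ • ((s : ℂ) * v) := by
      rw [zsmul_eq_mul]; push_cast; ring
    rw [h1, T.region_periodic _ _ (T.lattice.zsmul_mem hper _)]
    refine hseg _ ⟨?_, ?_⟩
    · have := Int.floor_le (t / s)
      rw [le_div_iff₀ hs] at this
      linarith
    · have := Int.lt_floor_add_one (t / s)
      rw [div_lt_iff₀ hs] at this
      linarith
  linarith

/-- Of the finitely many short lattice vectors, those that are not parallel to `v` have components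
perpendicular to `v` that are bounded away from zero. -/
theorem exists_lattice_gap (T : Table) (v : ℂ) (R : ℝ) : ∃ c > 0, ∀ l ∈ T.lattice, ‖l‖ ≤ R →
    (l * conj v).im ≠ 0 → c ≤ |(l * conj v).im| := by
  have := T.discrete
  have hfin : (Metric.closedBall (0 : ℂ) R ∩ (T.lattice : Set ℂ)).Finite :=
    Metric.finite_isBounded_inter_isClosed ⟨T.discrete⟩ Metric.isBounded_closedBall
      (AddSubgroup.isClosed_of_discrete (H := T.lattice))
  set S := {l ∈ Metric.closedBall (0 : ℂ) R ∩ (T.lattice : Set ℂ) | (l * conj v).im ≠ 0} with hS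
  have hSfin : S.Finite := hfin.subset (sep_subset _ _)
  rcases S.eq_empty_or_nonempty with he | hne
  · refine ⟨1, one_pos, fun l hl hR h0 => ?_⟩
    have : l ∈ S := ⟨⟨by simpa using hR, hl⟩, h0⟩
    rw [he] at this; exact this.elim
  · obtain ⟨a, ha, hmin⟩ := Set.exists_min_image S (fun l => |(l * conj v).im|) hSfin hne
    exact ⟨_, abs_pos.2 ha.2, fun l hl hR h0 => hmin l ⟨⟨by simpa using hR, hl⟩, h0⟩⟩

/-- Inverse continuity of the billiard map at a trajectory from `z` to `z'`, in a neighborhood of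
`z` that does not depend on `z'`: collisions near `z'` that come from this neighborhood come from
points near `z`, after nearly the same time and with the same lattice translation. A limit of
collisions for which this fails would end in the line of `z` as well; by convexity it would start at
`z`, and the two trajectories would differ by a lattice vector, against bounded horizon. -/
theorem exists_localization (hdisp : T.Dispersing) (hhor : T.BoundedHorizon) {i : Fin T.numWalls}
    {z : ℝ × ℝ} (hz : z ∈ T.phase i) : ∃ ρ > 0, ∀ (j : Fin T.numWalls) (z' : ℝ × ℝ) (t : ℝ) (l : ℂ),
      T.ClosedCollision i z j z' t l → ∀ ε > 0, ∃ η > 0, ∀ (w w' : ℝ × ℝ) (τ : ℝ) (l' : ℂ),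
        dist w z < ρ → dist w' z' < η → T.ClosedCollision i w j w' τ l' →
        dist w z < ε ∧ |τ - t| < ε ∧ l' = l := by
  obtain ⟨τmax, hmax⟩ := id hhor
  obtain ⟨δ, hδ, hinj⟩ := hdisp.exists_injective_line hz
  obtain ⟨c, hc, hgap⟩ := T.exists_lattice_gap (T.outVel i z) (2 * |τmax| + 1)
  obtain ⟨δ', hδ', hcont⟩ := Metric.continuousOn_iff.1 (T.continuousOn_curve_fst i) z hz (min c 1)
    (by positivity)
  refine ⟨min (δ / 2) (δ' / 2), by positivity, fun j z' t l hzc ε hε => ?_⟩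
  by_contra hcon
  push Not at hcon
  choose w w' τ l' hwz hw'z' hcol hbad using
    fun n : ℕ => hcon (1 / ((n : ℝ) + 1)) (by positivity)
  have hlim : Tendsto w' atTop (𝓝 z') := by
    rw [tendsto_iff_dist_tendsto_zero]
    exact squeeze_zero (fun _ => dist_nonneg) (fun n => (hw'z' n).le)
      tendsto_one_div_add_atTop_nhds_zero_nat
  have hbdd : Bornology.IsBounded (range w) :=
    (Metric.isBounded_closedBall (x := z) (r := min (δ / 2) (δ' / 2))).subset
      (range_subset_iff.2 fun n => (hwz n).le)
  obtain ⟨y, s, m, ψ, hψ, hy, hs, hm, hyc⟩ := exists_subseq_closedCollision hmax hcol hbdd hlim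
  have hyz : dist y z ≤ min (δ / 2) (δ' / 2) :=
    le_of_tendsto (hy.dist tendsto_const_nhds) (Eventually.of_forall fun n => (hwz _).le)
  have hyδ : dist y z < δ := by linarith [min_le_left (δ / 2) (δ' / 2)]
  have hyδ' : dist y z < δ' := by linarith [min_le_right (δ / 2) (δ' / 2)]
  have hvel : T.outVel i y = T.outVel i z := hyc.vel.trans hzc.vel.symm
  set v := T.outVel i z with hv
  have hvn : ‖v‖ = 1 := norm_outVel hz
  have hdiff : (T.wall i).curve y.1 - (T.wall i).curve z.1 = (t - s : ℝ) * v - (l - m) := by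
    have h1 := hyc.endpoint
    have h2 := hzc.endpoint
    rw [hvel] at h1
    push_cast
    linear_combination h1 - h2
  have hlm : l - m ∈ T.lattice := T.lattice.sub_mem hzc.mem_lattice hyc.mem_lattice
  have hsmall : ‖(T.wall i).curve y.1 - (T.wall i).curve z.1‖ < min c 1 := by
    rw [← dist_eq_norm]; exact hcont y hyc.mem_left hyδ'
  have ht0 := hzc.nonneg
  have hs0 := hyc.nonneg
  have htm := (hzc.le_of_horizon hmax).trans (le_abs_self _)
  have hsm := (hyc.le_of_horizon hmax).trans (le_abs_self _)
  have hvv : v * conj v = 1 := by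
    rw [Complex.mul_conj, Complex.normSq_eq_norm_sq, hvn]; simp
  -- otherwise the gap between lattice lines exceeds the distance of the two feet
  have him : ((l - m) * conj v).im = 0 := by
    by_contra hne
    have hnorm : ‖l - m‖ ≤ 2 * |τmax| + 1 := by
      have h1 : l - m = (t - s : ℝ) * v - ((T.wall i).curve y.1 - (T.wall i).curve z.1) := by
        rw [hdiff]; ring
      rw [h1]
      refine (norm_sub_le _ _).trans ?_
      rw [norm_mul, hvn, mul_one, Complex.norm_real, Real.norm_eq_abs]
      have h2 : |t - s| ≤ |τmax| := abs_le.2 ⟨by linarith, by linarith⟩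
      have h3 := hsmall.trans_le (min_le_right _ _)
      linarith [abs_nonneg τmax]
    have h1 := hgap _ hlm hnorm hne
    have h2 : ((l - m) * conj v).im =
        -(((T.wall i).curve y.1 - (T.wall i).curve z.1) * conj v).im := by
      rw [hdiff, sub_mul (_ * v), mul_assoc, hvv]; simp
    rw [h2, abs_neg] at h1
    have h3 := (h1.trans (Complex.abs_im_le_norm _))
    rw [norm_mul, Complex.norm_conj, hvn, mul_one] at h3
    linarith [hsmall.trans_le (min_le_left _ _)]
  have hlmv : l - m = ((l - m) * conj v).re * v := by
    have h1 : (((l - m) * conj v).re : ℂ) = (l - m) * conj v :=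
      Complex.ext (by simp) (by rw [him]; simp)
    rw [h1, mul_assoc, mul_comm (conj v), hvv, mul_one]
  -- the feet of `z` and `y` lie on one line, with the same direction
  have hyeq : z = y := by
    refine hinj z hz y hyc.mem_left (by simpa using hδ) hyδ hvel.symm
      (t - s - ((l - m) * conj v).re) ?_
    rw [← hv]
    push_cast at hdiff ⊢
    linear_combination hdiff - hlmv
  rw [← hyeq, sub_self] at hdiff
  have hlm' : ((t - s : ℝ) : ℂ) * v = l - m := by linear_combination -hdiff
  -- the segment between the two times would be periodic
  have hts : t = s := by
    rcases lt_trichotomy t s with hlt | heq | hgt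
    · refine (hhor.no_periodic_segment (p := (T.wall i).curve z.1) hvn (sub_pos.2 hlt)
        (fun x hx => ?_) ?_).elim
      · have := hyc.mem_region x ⟨hx.1, by linarith [hx.2]⟩
        rwa [hvel, ← hyeq] at this
      · have : ((s - t : ℝ) : ℂ) * v = -(l - m) := by
          rw [← hlm']; push_cast; ring
        rw [this]; exact T.lattice.neg_mem hlm
    · exact heq
    · refine (hhor.no_periodic_segment (p := (T.wall i).curve z.1) hvn (sub_pos.2 hgt)
        (fun x hx => hzc.mem_region x ⟨hx.1, by linarith [hx.2]⟩) ?_).elim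
      rw [hlm']; exact hlm
  have hlm0 : m = l := by
    rw [hts, sub_self, Complex.ofReal_zero, zero_mul] at hlm'
    linear_combination hlm'
  have hfar1 : ∀ᶠ n in atTop, dist (w (ψ n)) z < ε := by
    rw [← hyeq] at hy
    exact hy.eventually (Metric.ball_mem_nhds z hε)
  have hfar2 : ∀ᶠ n in atTop, |τ (ψ n) - t| < ε := by
    rw [← hts] at hs
    exact hs.eventually (Metric.ball_mem_nhds t hε)
  obtain ⟨n, h1, h2, h3⟩ := (hfar1.and (hfar2.and hm)).exists
  exact hbad (ψ n) h1 h2 (h3.trans hlm0)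

/-- The trajectory of `z` itself, followed until it reaches the center of the image of a sector. -/
theorem IsCenter.exists_closedCollision (hhor : T.BoundedHorizon) {i j : Fin T.numWalls}
    {z z' : ℝ × ℝ} {C : Set (ℝ × ℝ)} (hcl : z ∈ closure C) (h : T.IsCenter i z C j z') :
    ∃ t l, T.ClosedCollision i z j z' t l := by
  obtain ⟨τmax, hmax⟩ := hhor
  have : (𝓝[C] z).NeBot := mem_closure_iff_nhdsWithin_neBot.1 hcl
  have hex : ∀ n : ℕ, ∃ w w' : ℝ × ℝ, dist w z < 1 / ((n : ℝ) + 1) ∧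
      dist w' z' < 1 / ((n : ℝ) + 1) ∧ T.Collides i w j w' := fun n => by
    have hpos : 0 < 1 / ((n : ℝ) + 1) := by positivity
    obtain ⟨w, ⟨w', h1, h2⟩, h3⟩ := ((h.2 _ (Metric.ball_mem_nhds z' hpos)).and
      (mem_nhdsWithin_of_mem_nhds (Metric.ball_mem_nhds z hpos))).exists
    exact ⟨w, w', h3, h1, h2⟩
  choose w w' hw hw' hcol using hex
  choose τ l _ hcc _ using fun n => (hcol n).exists_closedCollision
  have hlim : ∀ (u : ℕ → ℝ × ℝ) (a : ℝ × ℝ), (∀ n : ℕ, dist (u n) a < 1 / ((n : ℝ) + 1)) →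
      Tendsto u atTop (𝓝 a) := fun u a hu => by
    rw [tendsto_iff_dist_tendsto_zero]
    exact squeeze_zero (fun _ => dist_nonneg) (fun n => (hu n).le)
      tendsto_one_div_add_atTop_nhds_zero_nat
  obtain ⟨y, t, m, ψ, hψ, hy, -, -, hyc⟩ := exists_subseq_closedCollision hmax hcc
    (Metric.isBounded_range_of_tendsto w (hlim w z hw)) (hlim w' z' hw')
  have hyz : y = z := tendsto_nhds_unique hy ((hlim w z hw).comp hψ.tendsto_atTop)
  exact ⟨t, m, hyz ▸ hyc⟩

end Table

/-! ### Lines near a transversal collision -/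

theorem Wall.sub_mem_interiorDom {w : Wall} {σ r₁ r₀ x : ℝ} (hσ : σ = 1 ∨ σ = -1)
    (hr₁ : r₁ ∈ w.dom) (hr₀ : r₀ ∈ w.interiorDom) (hx : 0 < x) (hle : x ≤ -(σ * (r₀ - r₁))) :
    r₁ - σ * x ∈ w.interiorDom := by
  rw [w.interiorDom_eq_interior] at hr₀ ⊢
  have hpos : 0 < -(σ * (r₀ - r₁)) := hx.trans_le hle
  have h := w.convex_dom.add_smul_sub_mem_interior hr₁ hr₀
    (t := x / -(σ * (r₀ - r₁))) ⟨by positivity, (div_le_one hpos).2 hle⟩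
  have hne : r₀ - r₁ ≠ 0 := by
    intro h0; rw [h0] at hpos; simp at hpos
  convert h using 1
  rcases hσ with rfl | rfl
  · simp only [smul_eq_mul]; field_simp; ring
  · simp only [smul_eq_mul]; field_simp; ring

theorem regularAngles_subset {k₀ : ℕ} (hk : 1 ≤ k₀) :
    regularAngles k₀ ⊆ Ioo (-(Real.pi / 2)) (Real.pi / 2) := by
  have hk' : (1 : ℝ) ≤ k₀ := by exact_mod_cast hk
  have h1 : 0 < 1 / (k₀ : ℝ) ^ 2 := by positivity
  have h2 : 1 / (k₀ : ℝ) ^ 2 ≤ 1 := (div_le_one (by positivity)).2 (by nlinarith)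
  have h3 : 0 < 1 / ((k₀ : ℝ) + 1) ^ 2 := by positivity
  have hpi := Real.pi_gt_three
  rintro φ ((⟨h, h'⟩ | ⟨h, h'⟩) | ⟨h, h'⟩) <;> constructor <;> linarith

namespace Table

variable {T : Table}

theorem norm_inVel {i : Fin T.numWalls} {z : ℝ × ℝ} (hz : z ∈ T.phase i) :
    ‖T.inVel i z‖ = 1 := by
  have h : T.inVel i z = (T.wall i).tangent z.1 *
      (Real.sin z.2 + (-Real.cos z.2 : ℝ) * Complex.I) := by
    rw [inVel]; push_cast; ring
  rw [h, norm_mul, norm_tangent hz.1, one_mul, ← sq_eq_sq₀ (norm_nonneg _) zero_le_one,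
    ← Complex.normSq_eq_norm_sq, Complex.normSq_add_mul_I]
  simp

theorem inVel_eq_exp (i : Fin T.numWalls) (z : ℝ × ℝ) :
    T.inVel i z = -Complex.I * (T.wall i).tangent z.1 * Complex.exp (z.2 * Complex.I) := by
  rw [inVel, Complex.exp_mul_I, Complex.ofReal_sin, Complex.ofReal_cos]
  linear_combination ((T.wall i).tangent z.1 * Complex.sin z.2) * Complex.I_sq

theorem tangent_mul_conj_inVel_exp {i : Fin T.numWalls} {z : ℝ × ℝ} (hz : z ∈ T.phase i) (α : ℝ) :
    ((T.wall i).tangent z.1 * conj (T.inVel i z * Complex.exp (α * Complex.I))).im =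
      Real.cos (z.2 + α) := by
  have h : (T.wall i).tangent z.1 * conj (T.inVel i z * Complex.exp (α * Complex.I)) =
      Complex.I * Complex.exp ((-(z.2 + α) : ℝ) * Complex.I) := by
    rw [inVel_eq_exp, map_mul, map_mul, map_mul, map_neg, Complex.conj_I, ← Complex.exp_conj,
      ← Complex.exp_conj, map_mul, map_mul, Complex.conj_I, Complex.conj_ofReal,
      Complex.conj_ofReal]
    have h1 : Complex.exp ((-(z.2 + α) : ℝ) * Complex.I) =
        Complex.exp (z.2 * -Complex.I) * Complex.exp (α * -Complex.I) := by
      rw [← Complex.exp_add]; congr 1; push_cast; ring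
    rw [h1]
    linear_combination Complex.I * Complex.exp (z.2 * -Complex.I) * Complex.exp (α * -Complex.I)
      * tangent_mul_conj hz.1
  rw [h, Complex.I_mul_im, Complex.exp_ofReal_mul_I_re, Real.cos_neg]

/-- Transversality: at a non-grazing point the wall meets each oriented line near the incoming
trajectory that passes on the side where the wall extends. Here `a` is the distance of the line
from the point of collision, on the right for `σ = 1` and on the left for `σ = -1`, and `α` is
its angle with the trajectory. -/
theorem exists_hit {j : Fin T.numWalls} {z' : ℝ × ℝ} (hz' : z' ∈ T.phase j)
    (hcos : 0 < Real.cos z'.2) {σ : ℝ} (hσ : σ = 1 ∨ σ = -1)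
    (hside : ∃ r ∈ (T.wall j).interiorDom, σ * (r - z'.1) < 0) :
    ∃ C > 0, ∀ ε > 0, ∃ δ > 0, ∀ a α : ℝ, 0 < a → a < δ → |α| < δ →
      ∃ r ∈ (T.wall j).interiorDom, ∃ s : ℝ, σ * (r - z'.1) < 0 ∧ |r - z'.1| ≤ C * a ∧ |s| < ε ∧
        (T.wall j).curve r = (T.wall j).curve z'.1
          + s * (T.inVel j z' * Complex.exp (α * Complex.I)) - σ * a * (Complex.I * T.inVel j z') := by
  set k := Real.cos z'.2 with hk
  have hk1 : k ≤ 1 := Real.cos_le_one _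
  have hσσ : σ * σ = 1 := by rcases hσ with rfl | rfl <;> norm_num
  have hσa : |σ| = 1 := by rcases hσ with rfl | rfl <;> simp
  obtain ⟨δ₁, hδ₁, hst⟩ := Wall.exists_strict_deriv (T.len_pos j) (T.smooth j) hz'.1
    (show (0 : ℝ) < k / 4 by positivity)
  obtain ⟨r₀, hr₀, hr₀s⟩ := hside
  set h := min (δ₁ / 2) (-(σ * (r₀ - z'.1))) with hh
  have hpos : 0 < h := lt_min (by positivity) (by linarith)
  obtain ⟨δ₂, hδ₂, hcont⟩ := Metric.continuousAt_iff.1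
    (Real.continuous_cos.continuousAt (x := z'.2)) (k / 2) (by positivity)
  refine ⟨4 / k, by positivity, fun ε hε => ⟨min (min δ₂ 1) (min (h * k / 4) (ε / (8 / k + 1))),
    by positivity, fun a α ha haδ hαδ => ?_⟩⟩
  have hα₂ : |α| < δ₂ := hαδ.trans_le ((min_le_left _ _).trans (min_le_left _ _))
  have hα₁ : |α| < 1 := hαδ.trans_le ((min_le_left _ _).trans (min_le_right _ _))
  have ha₁ : a < h * k / 4 := haδ.trans_le ((min_le_right _ _).trans (min_le_left _ _))
  have ha₂ : a < ε / (8 / k + 1) := haδ.trans_le ((min_le_right _ _).trans (min_le_right _ _))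
  have hkα : k / 2 ≤ Real.cos (z'.2 + α) := by
    have := hcont (x := z'.2 + α) (by rwa [Real.dist_eq, add_sub_cancel_left])
    rw [Real.dist_eq] at this
    linarith [(abs_lt.1 this).1]
  have hcosα : 0 < Real.cos α := Real.cos_pos_of_le_one hα₁.le
  set v := T.inVel j z' with hv
  set u := v * Complex.exp (α * Complex.I) with hu
  have hvn : ‖v‖ = 1 := norm_inVel hz'
  have hvv : v * conj v = 1 := by
    rw [Complex.mul_conj, Complex.normSq_eq_norm_sq, hvn]; simp
  have hun : ‖u‖ = 1 := by rw [hu, norm_mul, hvn, Complex.norm_exp_ofReal_mul_I, one_mul]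
  have huu : u * conj u = 1 := by
    rw [Complex.mul_conj, Complex.normSq_eq_norm_sq, hun]; simp
  have hvu : (v * conj u).re = Real.cos α := by
    have : v * conj u = Complex.exp ((-α : ℝ) * Complex.I) := by
      rw [hu, map_mul, ← mul_assoc, hvv, one_mul, ← Complex.exp_conj]; congr 1; simp
    rw [this, Complex.exp_ofReal_mul_I_re, Real.cos_neg]
  set γ := (T.wall j).curve with hγ
  set τ := (T.wall j).tangent z'.1 with hτ
  have hτn : ‖τ‖ = 1 := norm_tangent hz'.1
  have hτu : (τ * conj u).im = Real.cos (z'.2 + α) := tangent_mul_conj_inVel_exp hz' α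
  have hIvu : ((σ * a : ℝ) * (Complex.I * v) * conj u).im = σ * a * Real.cos α := by
    rw [mul_assoc, Complex.im_ofReal_mul, mul_assoc Complex.I, Complex.I_mul_im, hvu, mul_assoc]
  -- signed distance from the line; it changes sign along the wall, and its zeros are hits
  set G : ℝ → ℝ := fun r => ((γ r - γ z'.1 + (σ * a : ℝ) * (Complex.I * v)) * conj u).im with hG
  have hmem : ∀ x, 0 < x → x ≤ h → z'.1 - σ * x ∈ (T.wall j).interiorDom := fun x hx hxh =>
    Wall.sub_mem_interiorDom hσ hz'.1 hr₀ hx (hxh.trans (min_le_right _ _))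
  have hintdom := (T.wall j).interiorDom_subset_dom
  have hmem' : ∀ x ∈ Icc 0 h, z'.1 - σ * x ∈ (T.wall j).dom := fun x hx => by
    rcases hx.1.eq_or_lt with h0 | h0
    · rw [← h0]; simpa using hz'.1
    · exact hintdom (hmem x h0 hx.2)
  have habs : ∀ x, 0 ≤ x → |z'.1 - σ * x - z'.1| = x := fun x hx => by
    rw [sub_sub_cancel_left, abs_neg, abs_mul, hσa, one_mul, abs_of_nonneg hx]
  have hest : ∀ x ∈ Icc 0 h, |G (z'.1 - σ * x) - (-(σ * x) * Real.cos (z'.2 + α)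
      + σ * a * Real.cos α)| ≤ k / 4 * x ∧ ‖γ (z'.1 - σ * x) - γ z'.1‖ ≤ 2 * x := fun x hx => by
    have h1 := hst _ (hmem' x hx) _ hz'.1
      (by rw [habs x hx.1]; linarith [hx.2, min_le_left (δ₁ / 2) (-(σ * (r₀ - z'.1)))])
      (by simpa using hδ₁)
    rw [habs x hx.1] at h1
    set E := γ (z'.1 - σ * x) - γ z'.1 - (z'.1 - σ * x - z'.1 : ℝ) * τ with hE
    have h2 : γ (z'.1 - σ * x) - γ z'.1 = E + (-(σ * x) : ℝ) * τ := by
      rw [hE]; push_cast; ring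
    constructor
    · have h3 : G (z'.1 - σ * x) - (-(σ * x) * Real.cos (z'.2 + α) + σ * a * Real.cos α) =
          (E * conj u).im := by
        simp only [hG]
        rw [h2, add_mul, add_mul, Complex.add_im, Complex.add_im, hIvu, mul_assoc (_ : ℂ) τ,
          Complex.im_ofReal_mul, hτu]
        ring
      rw [h3]
      refine (Complex.abs_im_le_norm _).trans ?_
      rwa [norm_mul, Complex.norm_conj, hun, mul_one]
    · rw [h2]
      refine (norm_add_le _ _).trans ?_
      rw [norm_mul, hτn, mul_one, Complex.norm_real, Real.norm_eq_abs, abs_neg, abs_mul, hσa,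
        one_mul, abs_of_nonneg hx.1]
      nlinarith [hx.1]
  have hGc : ContinuousOn (fun x => σ * G (z'.1 - σ * x)) (Icc 0 h) := by
    have h1 : ContinuousOn (fun x : ℝ => γ (z'.1 - σ * x)) (Icc 0 h) :=
      (T.smooth j).continuousOn.comp (by fun_prop) hmem'
    refine continuousOn_const.mul (Complex.continuous_im.comp_continuousOn ?_)
    exact ((h1.sub continuousOn_const).add continuousOn_const).mul continuousOn_const
  have hσmul : ∀ x ∈ Icc 0 h, |σ * G (z'.1 - σ * x) - (a * Real.cos α
      - x * Real.cos (z'.2 + α))| ≤ k / 4 * x := fun x hx => by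
    have h1 := (hest x hx).1
    have h2 : σ * G (z'.1 - σ * x) - (a * Real.cos α - x * Real.cos (z'.2 + α)) =
        σ * (G (z'.1 - σ * x) - (-(σ * x) * Real.cos (z'.2 + α) + σ * a * Real.cos α)) := by
      linear_combination (a * Real.cos α - x * Real.cos (z'.2 + α)) * hσσ
    rwa [h2, abs_mul, hσa, one_mul]
  have hG0 : 0 < σ * G (z'.1 - σ * 0) := by
    have := (abs_le.1 (hσmul 0 ⟨le_rfl, hpos.le⟩)).1
    nlinarith [mul_pos ha hcosα]
  have hGh : σ * G (z'.1 - σ * h) < 0 := by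
    have := (abs_le.1 (hσmul h ⟨hpos.le, le_rfl⟩)).2
    nlinarith [Real.cos_le_one α]
  obtain ⟨x, hx, hx0⟩ := intermediate_value_Icc' hpos.le hGc ⟨hGh.le, hG0.le⟩
  simp only at hx0
  have hxpos : 0 < x := by
    rcases hx.1.eq_or_lt with h0 | h0
    · rw [← h0] at hx0; linarith
    · exact h0
  have hxa : x ≤ 4 / k * a := by
    have := (abs_le.1 (hσmul x hx)).2
    rw [hx0] at this
    rw [div_mul_eq_mul_div, le_div_iff₀ hcos]
    have h1 := mul_le_mul_of_nonneg_left hkα hxpos.le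
    have h2 := mul_le_mul_of_nonneg_left (Real.cos_le_one α) ha.le
    linarith
  set q := γ (z'.1 - σ * x) - γ z'.1 + (σ * a : ℝ) * (Complex.I * v) with hq
  have hqim : (q * conj u).im = 0 := by
    have : σ * (σ * (q * conj u).im) = 0 := by
      have h1 : σ * (q * conj u).im = 0 := hx0
      rw [h1, mul_zero]
    rwa [← mul_assoc, hσσ, one_mul] at this
  refine ⟨z'.1 - σ * x, hmem x hxpos hx.2, (q * conj u).re, ?_, ?_, ?_, ?_⟩
  · have : σ * (z'.1 - σ * x - z'.1) = -x := by linear_combination -x * hσσ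
    rw [this]; linarith
  · rw [habs x hx.1]; exact hxa
  · refine (Complex.abs_re_le_norm _).trans_lt ?_
    rw [norm_mul, Complex.norm_conj, hun, mul_one]
    have h1 : ‖q‖ ≤ 2 * x + a := by
      refine (norm_add_le _ _).trans (add_le_add (hest x hx).2 ?_)
      rw [norm_mul, norm_mul, hvn, Complex.norm_I, Complex.norm_real, Real.norm_eq_abs, abs_mul,
        hσa, abs_of_pos ha]
      linarith
    have h2 : 2 * x + a ≤ (8 / k + 1) * a := by
      have : 8 / k = 2 * (4 / k) := by ring
      rw [this]; linarith
    rw [lt_div_iff₀ (by positivity)] at ha₂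
    linarith
  · have h1 : (((q * conj u).re : ℝ) : ℂ) = q * conj u :=
      Complex.ext (by simp) (by rw [hqim]; simp)
    rw [h1, mul_assoc, mul_comm (conj u), huu, mul_one, hq]
    push_cast; ring

/-- The lines of `exists_hit` that are turned to the side of the trajectory opposite to the one on
which they pass (to the left for `σ = 1`), by an angle `b` at least `M` times their distance `a` from
the point of collision, hit the wall in the given active quadrant. -/
theorem exists_hit_in_quadrant {j : Fin T.numWalls} {z' : ℝ × ℝ} (hz' : z' ∈ T.phase j)
    (hφ : z'.2 ∈ Ioo (-(Real.pi / 2)) (Real.pi / 2)) {σ : ℝ} (hσ : σ = 1 ∨ σ = -1)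
    (hside : ∃ r ∈ (T.wall j).interiorDom, σ * (r - z'.1) < 0) {q : Quadrant}
    (hq : ∀ x y, q.Contains x y ↔ σ * x < 0 ∧ 0 < σ * y) :
    ∃ M > 0, ∀ ε > 0, ∃ δ > 0, ∀ a b : ℝ, 0 < a → b < δ → M * a ≤ b →
      ∃ w ∈ T.quadrant j z' ε q, ∃ s : ℝ, |s| < ε ∧
        (T.wall j).curve w.1 = (T.wall j).curve z'.1
          + s * (T.inVel j z' * Complex.exp ((σ * b : ℝ) * Complex.I))
          - σ * a * (Complex.I * T.inVel j z') ∧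
        T.inVel j w = T.inVel j z' * Complex.exp ((σ * b : ℝ) * Complex.I) := by
  have hσσ : σ * σ = 1 := by rcases hσ with rfl | rfl <;> norm_num
  have hσa : |σ| = 1 := by rcases hσ with rfl | rfl <;> simp
  obtain ⟨C, hC, hhit⟩ := exists_hit hz' (Real.cos_pos_of_mem_Ioo hφ) hσ hside
  obtain ⟨K, hK, δ₁, hδ₁, hlip⟩ := Wall.exists_tangent_lipschitz (T.len_pos j) (T.smooth j) hz'.1
  set M := 2 * K * C + C + 1 with hM
  have hMpos : 0 < M := by positivity
  refine ⟨M, hMpos, fun ε hε => ?_⟩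
  obtain ⟨δ, hδ, hhit⟩ := hhit ε hε
  set g := min (z'.2 + Real.pi / 2) (Real.pi / 2 - z'.2) with hg
  have hgpos : 0 < g := lt_min (by linarith [hφ.1]) (by linarith [hφ.2])
  refine ⟨min (min δ δ₁) (min (ε / 4) (g / 2)), by positivity, fun a b ha hb hMb => ?_⟩
  have hbδ : b < δ := hb.trans_le ((min_le_left _ _).trans (min_le_left _ _))
  have hbδ₁ : b < δ₁ := hb.trans_le ((min_le_left _ _).trans (min_le_right _ _))
  have hbε : b < ε / 4 := hb.trans_le ((min_le_right _ _).trans (min_le_left _ _))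
  have hbg : b < g / 2 := hb.trans_le ((min_le_right _ _).trans (min_le_right _ _))
  have hKCa : 0 < K * C * a := by positivity
  have hCa : 0 < C * a := by positivity
  have hMa : 2 * K * C * a + C * a + a ≤ b := by rw [hM] at hMb; linarith
  have hbpos : 0 < b := by nlinarith
  obtain ⟨r, hr, s, hrs, hra, hs, hcurve⟩ := hhit a (σ * b) ha (by nlinarith)
    (by rwa [abs_mul, hσa, one_mul, abs_of_pos hbpos])
  have hrd : r ∈ (T.wall j).dom := Wall.interiorDom_subset_dom _ hr
  set τ := (T.wall j).tangent r with hτ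
  set τ' := (T.wall j).tangent z'.1 with hτ'
  have hτn : ‖τ‖ = 1 := norm_tangent hrd
  have hτn' : ‖τ'‖ = 1 := norm_tangent hz'.1
  have hτ0 : τ ≠ 0 := norm_ne_zero_iff.1 (by rw [hτn]; exact one_ne_zero)
  have hτ0' : τ' ≠ 0 := norm_ne_zero_iff.1 (by rw [hτn']; exact one_ne_zero)
  set β := (τ / τ').arg with hβ
  have hβexp : τ = τ' * Complex.exp (β * Complex.I) := by
    have h1 := Complex.norm_mul_exp_arg_mul_I (τ / τ')
    rw [norm_div, hτn, hτn', div_one, Complex.ofReal_one, one_mul] at h1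
    rw [hβ, h1, mul_div_cancel₀ _ hτ0']
  have hβle : |β| ≤ 2 * K * C * a := by
    have h1 := Complex.angle_le_mul_norm_sub hτn hτn'
    rw [Complex.angle_eq_abs_arg hτ0 hτ0'] at h1
    have h2 : ‖τ - τ'‖ ≤ K * |r - z'.1| := hlip r hrd z'.1 hz'.1 (by nlinarith)
      (by simpa using hδ₁)
    have h3 : K * |r - z'.1| ≤ K * (C * a) := by gcongr
    have h4 := Real.pi_lt_d2
    have h5 : Real.pi / 2 * ‖τ - τ'‖ ≤ 2 * ‖τ - τ'‖ := by gcongr; linarith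
    linarith
  have hσβ : |σ * β| ≤ 2 * K * C * a := by rwa [abs_mul, hσa, one_mul]
  -- turning the line by `σ * b` and the tangent by `β` changes the angle by the difference
  set φ := z'.2 + (σ * b - β) with hφdef
  have hφabs : |σ * b - β| < 2 * b := by
    have h1 : σ * (σ * b - β) = b - σ * β := by linear_combination b * hσσ
    have h2 : |σ * b - β| = |b - σ * β| := by rw [← h1, abs_mul, hσa, one_mul]
    rw [h2, abs_lt]
    have := abs_le.1 hσβ
    constructor <;> linarith
  have hφ' := abs_lt.1 hφabs
  have hg1 : g ≤ z'.2 + Real.pi / 2 := min_le_left _ _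
  have hg2 : g ≤ Real.pi / 2 - z'.2 := min_le_right _ _
  have hφm : φ ∈ Ioo (-(Real.pi / 2)) (Real.pi / 2) := ⟨by linarith, by linarith⟩
  refine ⟨(r, φ), ⟨⟨hrd, Ioo_subset_Icc_self hφm⟩, ?_, ?_, ?_⟩, s, hs, hcurve, ?_⟩
  · rintro ⟨-, h1 | h1 | h1⟩
    · exact h1 hr
    · exact hφm.2.ne h1
    · exact hφm.1.ne' h1
  · have h1 : |r - z'.1| < ε / 2 := by linarith
    have h2 : |φ - z'.2| < ε / 2 := by rw [hφdef, add_sub_cancel_left]; linarith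
    have h3 := sq_lt_sq' (by linarith [abs_nonneg (r - z'.1)]) h1
    have h4 := sq_lt_sq' (by linarith [abs_nonneg (φ - z'.2)]) h2
    rw [sq_abs] at h3 h4
    simp only
    nlinarith
  · rw [hq]
    refine ⟨hrs, ?_⟩
    have h1 : σ * (φ - z'.2) = b - σ * β := by
      rw [hφdef]; linear_combination b * hσσ
    simp only
    rw [h1]
    linarith [(abs_le.1 hσβ).2]
  · rw [inVel_eq_exp, inVel_eq_exp]
    simp only
    have h1 : Complex.exp (β * Complex.I) * Complex.exp (φ * Complex.I) =
        Complex.exp (z'.2 * Complex.I) * Complex.exp ((σ * b : ℝ) * Complex.I) := by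
      rw [← Complex.exp_add, ← Complex.exp_add, hφdef]; congr 1; push_cast; ring
    rw [← hτ, ← hτ', hβexp]
    linear_combination (-Complex.I * τ') * h1

/-- Near a non-grazing collision the wall is a Lipschitz graph over the direction perpendicular to
the incoming trajectory. -/
theorem exists_lipschitz_graph {j : Fin T.numWalls} {z' : ℝ × ℝ} (hz' : z' ∈ T.phase j)
    (hcos : 0 < Real.cos z'.2) : ∃ L > 0, ∃ δ > 0, ∀ r ∈ (T.wall j).dom, ∀ r' ∈ (T.wall j).dom,
      |r - z'.1| < δ → |r' - z'.1| < δ →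
      ‖(T.wall j).curve r - (T.wall j).curve r'‖ ≤
        L * |(((T.wall j).curve r - (T.wall j).curve r') * conj (T.inVel j z')).im| := by
  set k := Real.cos z'.2 with hk
  have hk1 : k ≤ 1 := Real.cos_le_one _
  obtain ⟨δ, hδ, hst⟩ := Wall.exists_strict_deriv (T.len_pos j) (T.smooth j) hz'.1
    (show (0 : ℝ) < k / 4 by positivity)
  refine ⟨4 / k, by positivity, δ, hδ, fun r hr r' hr' h h' => ?_⟩
  have h1 := hst r hr r' hr' h h'
  set Δ := (T.wall j).curve r - (T.wall j).curve r' with hΔ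
  set E := Δ - (r - r' : ℝ) * (T.wall j).tangent z'.1 with hE
  have hΔE : Δ = E + (r - r' : ℝ) * (T.wall j).tangent z'.1 := by rw [hE]; ring
  have h2 := tangent_mul_conj_inVel_exp hz' 0
  simp only [Complex.ofReal_zero, zero_mul, Complex.exp_zero, mul_one, add_zero] at h2
  have h3 : (Δ * conj (T.inVel j z')).im = (E * conj (T.inVel j z')).im + (r - r') * k := by
    rw [hΔE, add_mul, Complex.add_im, mul_assoc, Complex.im_ofReal_mul, h2]
  have h4 : |(E * conj (T.inVel j z')).im| ≤ k / 4 * |r - r'| := by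
    refine (Complex.abs_im_le_norm _).trans ?_
    rwa [norm_mul, Complex.norm_conj, norm_inVel hz', mul_one]
  have h5 : 3 / 4 * k * |r - r'| ≤ |(Δ * conj (T.inVel j z')).im| := by
    have h6 : |(r - r') * k| = k * |r - r'| := by rw [abs_mul, abs_of_pos hcos, mul_comm]
    have h7 : (r - r') * k = (Δ * conj (T.inVel j z')).im - (E * conj (T.inVel j z')).im := by
      rw [h3]; ring
    have h8 := abs_sub (Δ * conj (T.inVel j z')).im (E * conj (T.inVel j z')).im
    rw [← h7, h6] at h8
    linarith
  have h6 : ‖Δ‖ ≤ 2 * |r - r'| := by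
    rw [hΔE]
    refine (norm_add_le _ _).trans ?_
    rw [norm_mul, norm_tangent hz'.1, mul_one, Complex.norm_real, Real.norm_eq_abs]
    nlinarith [abs_nonneg (r - r')]
  rw [div_mul_eq_mul_div, le_div_iff₀ hcos]
  nlinarith [abs_nonneg (r - r')]

end Table

/-! ### Centers whose neighborhoods are covered by pencils of trajectories -/

/-- The two active quadrants are distinguished by a sign: `1` for the south-east, `-1` for the
north-west quadrant. -/
theorem Quadrant.IsActive.exists_sign {q : Quadrant} (hq : q.IsActive) :
    ∃ σ : ℝ, (σ = 1 ∨ σ = -1) ∧ ∀ x y, q.Contains x y ↔ 0 < σ * x ∧ σ * y < 0 := by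
  rcases hq with rfl | rfl
  · exact ⟨-1, Or.inr rfl, fun x y => by simp [Quadrant.Contains]⟩
  · exact ⟨1, Or.inl rfl, fun x y => by simp [Quadrant.Contains]⟩

namespace Table

variable {T : Table}

theorem dist_lt_of_mem_quadrant {i : Fin T.numWalls} {z w : ℝ × ℝ} {ρ : ℝ} (hρ : 0 < ρ)
    {q : Quadrant} (hw : w ∈ T.quadrant i z ρ q) : dist w z < ρ := by
  have h := hw.2.2.1
  rw [Prod.dist_eq, max_lt_iff, Real.dist_eq, Real.dist_eq]
  exact ⟨abs_lt_of_sq_lt_sq (by nlinarith [sq_nonneg (w.2 - z.2)]) hρ.le,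
    abs_lt_of_sq_lt_sq (by nlinarith [sq_nonneg (w.1 - z.1)]) hρ.le⟩

theorem exists_interiorDom_of_quadrant_nonempty {j : Fin T.numWalls} {z' : ℝ × ℝ} {ρ σ : ℝ}
    {q : Quadrant} (hq : ∀ x y, q.Contains x y ↔ σ * x < 0 ∧ 0 < σ * y)
    (hne : (T.quadrant j z' ρ q).Nonempty) :
    ∃ r ∈ (T.wall j).interiorDom, σ * (r - z'.1) < 0 := by
  obtain ⟨w, hw, hsing, -, hc⟩ := hne
  refine ⟨w.1, ?_, ((hq _ _).1 hc).1⟩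
  by_contra hcon
  exact hsing ⟨hw, Or.inl hcon⟩

/-- The trajectory of `z` reaches, transversally, the wall `j` at `z'` after time `t`, the wall
extends to its right (`σ = 1`) or to its left (`σ = -1`), and there is `M > 0` such that every
oriented line which is close to the trajectory, passes `z'` on this side at distance `a`, and
is turned to the other side by an angle `b ≥ M * a`, contains a trajectory from a point of `C` close
to `z` to a point of the wall close to `z'`. -/
structure IsTransverseTarget (T : Table) (i : Fin T.numWalls) (z : ℝ × ℝ) (C : Set (ℝ × ℝ))
    (j : Fin T.numWalls) (z' : ℝ × ℝ) (t : ℝ) (l : ℂ) (σ : ℝ) : Prop where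
  collision : T.ClosedCollision i z j z' t l
  transverse : z'.2 ∈ Ioo (-(Real.pi / 2)) (Real.pi / 2)
  side : ∃ r ∈ (T.wall j).interiorDom, σ * (r - z'.1) < 0
  pencil : ∃ M > 0, ∀ ε > 0, ∃ δ > 0, ∀ a b : ℝ, 0 < a → b < δ → M * a ≤ b →
    ∃ w ∈ C, ∃ w' ∈ T.phase j, ∃ τ s : ℝ, 0 < τ ∧ dist w z < ε ∧ |w'.1 - z'.1| < ε ∧ |τ - t| < ε ∧
      |s| < ε ∧ T.outVel i w = T.outVel i z * Complex.exp ((σ * b : ℝ) * Complex.I) ∧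
      (∀ x ∈ Ioo 0 τ, (T.wall i).curve w.1 + x * T.outVel i w ∈ interior T.region) ∧
      (T.wall i).curve w.1 + τ * T.outVel i w = (T.wall j).curve w'.1 + l ∧
      (T.wall i).curve w.1 + τ * T.outVel i w = (T.wall i).curve z.1 + t * T.outVel i z
        + s * T.outVel i w - σ * a * (Complex.I * T.outVel i z)

/-- An active quadrant in the image of `C` provides the trajectories that `IsTransverseTarget`
requires. -/
theorem exists_isTransverseTarget {i j : Fin T.numWalls} {z z' : ℝ × ℝ} {ρ t σ : ℝ} {l : ℂ}
    (hσ : σ = 1 ∨ σ = -1) {C : Set (ℝ × ℝ)} (hC : ∀ w ∈ C, dist w z < ρ)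
    (hcol : T.ClosedCollision i z j z' t l)
    (hloc : ∀ ε > 0, ∃ η > 0, ∀ (w w' : ℝ × ℝ) (τ : ℝ) (l' : ℂ),
      dist w z < ρ → dist w' z' < η → T.ClosedCollision i w j w' τ l' →
      dist w z < ε ∧ |τ - t| < ε ∧ l' = l)
    (hφ : z'.2 ∈ Ioo (-(Real.pi / 2)) (Real.pi / 2)) {q : Quadrant}
    (hq : ∀ x y, q.Contains x y ↔ σ * x < 0 ∧ 0 < σ * y) {ρ' : ℝ} (hρ' : 0 < ρ')
    (hne : (T.quadrant j z' ρ' q).Nonempty) (hsub : T.quadrant j z' ρ' q ⊆ T.image i C j) :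
    T.IsTransverseTarget i z C j z' t l σ := by
  have hside := exists_interiorDom_of_quadrant_nonempty hq hne
  refine ⟨hcol, hφ, hside, ?_⟩
  obtain ⟨M, hM, hhit⟩ := exists_hit_in_quadrant hcol.mem_right hφ hσ hside hq
  refine ⟨M, hM, fun ε hε => ?_⟩
  obtain ⟨η, hη, hloc⟩ := hloc ε hε
  set ε' := min (min ε η) ρ' with hε'
  have hε'pos : 0 < ε' := by positivity
  obtain ⟨δ, hδ, hhit⟩ := hhit ε' hε'pos
  refine ⟨δ, hδ, fun a b ha hb hMb => ?_⟩
  obtain ⟨w', hw', s, hs, hcur, hvel⟩ := hhit a b ha hb hMb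
  have hd' := dist_lt_of_mem_quadrant hε'pos hw'
  have hw'2 : w' ∈ T.quadrant j z' ρ' q := ⟨hw'.1, hw'.2.1, hw'.2.2.1.trans_le
    (pow_le_pow_left₀ hε'pos.le (min_le_right _ _) 2), hw'.2.2.2⟩
  obtain ⟨w, hwC, hwcol⟩ := hsub hw'2
  obtain ⟨τ, l', hτ, hcc, hint⟩ := hwcol.exists_closedCollision
  obtain ⟨h1, h2, rfl⟩ := hloc w w' τ l' (hC w hwC)
    (hd'.trans_le ((min_le_left _ _).trans (min_le_right _ _))) hcc
  refine ⟨w, hwC, w', hw'.1, τ, s, hτ, h1, ?_, h2,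
    hs.trans_le ((min_le_left _ _).trans (min_le_left _ _)), ?_, hint, hcc.endpoint, ?_⟩
  · exact ((le_max_left _ _).trans_lt hd').trans_le ((min_le_left _ _).trans (min_le_left _ _))
  · rw [hcc.vel, hvel, hcol.vel]
  · rw [hcc.endpoint, hcol.endpoint, hcur, hcc.vel, hvel, hcol.vel]; ring

theorem mul_conj_outVel {i : Fin T.numWalls} {z : ℝ × ℝ} (hz : z ∈ T.phase i) :
    T.outVel i z * conj (T.outVel i z) = 1 := by
  rw [Complex.mul_conj, Complex.normSq_eq_norm_sq, norm_outVel hz]; simp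

theorem sin_sign_mul {σ : ℝ} (hσ : σ = 1 ∨ σ = -1) (b : ℝ) :
    Real.sin (σ * b) = σ * Real.sin b := by
  rcases hσ with rfl | rfl <;> simp

theorem cos_sign_mul {σ : ℝ} (hσ : σ = 1 ∨ σ = -1) (b : ℝ) : Real.cos (σ * b) = Real.cos b := by
  rcases hσ with rfl | rfl <;> simp

theorem exp_sign_mul {σ : ℝ} (hσ : σ = 1 ∨ σ = -1) (b : ℝ) :
    Complex.exp ((σ * b : ℝ) * Complex.I) =
      (Real.cos b : ℝ) + (σ * Real.sin b : ℝ) * Complex.I := by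
  rw [Complex.exp_mul_I, ← Complex.ofReal_cos, ← Complex.ofReal_sin, cos_sign_mul hσ,
    sin_sign_mul hσ]

theorem half_lt_cos {b : ℝ} (hb : 0 < b) (hb1 : b ≤ 1) : 1 / 2 < Real.cos b := by
  have := Real.one_sub_sq_div_two_lt_cos hb.ne'
  nlinarith

/-- The image of a sector of an active quadrant contains no active quadrant of the same sign:
followed backwards, the trajectories of the latter move away from the trajectory of `z`, so that
their feet lie on the wrong side of it. -/
theorem IsTransverseTarget.false_of_neg {i j : Fin T.numWalls} {z z' : ℝ × ℝ} {t σ : ℝ} {l : ℂ}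
    (hσ : σ = 1 ∨ σ = -1) {C : Set (ℝ × ℝ)}
    (hfoot : ∀ w ∈ C,
      σ * (((T.wall i).curve w.1 - (T.wall i).curve z.1) * conj (T.outVel i z)).im < 0)
    (h : T.IsTransverseTarget i z C j z' t l (-σ)) : False := by
  have hσσ : σ * σ = 1 := by rcases hσ with rfl | rfl <;> norm_num
  have hσ' : -σ = 1 ∨ -σ = -1 := by rcases hσ with rfl | rfl <;> simp
  obtain ⟨M, hM, hp⟩ := h.pencil
  obtain ⟨δ, hδ, hp⟩ := hp (1 / (2 * M)) (by positivity)
  set b := min (δ / 2) 1 with hb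
  have hbpos : 0 < b := by positivity
  have hbδ : b < δ := (min_le_left _ _).trans_lt (by linarith)
  obtain ⟨w, hw, w', -, τ, s, hτ, -, -, -, hs, hvel, -, -, heq⟩ := hp (b / M) b (by positivity) hbδ
    (by rw [mul_div_cancel₀ _ hM.ne'])
  have hf := hfoot w hw
  set v := T.outVel i z with hv
  have hvv : v * conj v = 1 := mul_conj_outVel h.collision.mem_left
  rw [hvel, exp_sign_mul hσ'] at heq
  have h1 : ((T.wall i).curve w.1 - (T.wall i).curve z.1) * conj v =
      (t + (s - τ) * ((Real.cos b : ℝ) + (-σ * Real.sin b : ℝ) * Complex.I))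
        + (σ * (b / M) : ℝ) * Complex.I := by
    push_cast at heq ⊢
    linear_combination (conj v) * heq + (t + (s - τ) * (Complex.cos b + (-σ * Complex.sin b) *
      Complex.I) + (σ * (b / M)) * Complex.I) * hvv
  have h2 : (((T.wall i).curve w.1 - (T.wall i).curve z.1) * conj v).im =
      (s - τ) * (-σ * Real.sin b) + σ * (b / M) := by
    rw [h1, ← Complex.ofReal_sub, Complex.add_im, Complex.add_im, Complex.im_ofReal_mul,
      Complex.add_im, Complex.im_ofReal_mul, Complex.im_ofReal_mul, Complex.ofReal_im,
      Complex.ofReal_im, Complex.I_im]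
    ring
  have h3 : σ * ((s - τ) * (-σ * Real.sin b) + σ * (b / M)) =
      (τ - s) * Real.sin b + b / M := by
    linear_combination ((τ - s) * Real.sin b + b / M) * hσσ
  rw [h2, h3] at hf
  have hsin0 : 0 < Real.sin b := Real.sin_pos_of_pos_of_lt_pi hbpos
    (by linarith [min_le_right (δ / 2) 1, Real.pi_gt_three])
  have hsin1 : Real.sin b ≤ b := Real.sin_le hbpos.le
  have h4 : s * Real.sin b ≤ 1 / (2 * M) * b :=
    mul_le_mul ((le_abs_self s).trans hs.le) hsin1 hsin0.le (by positivity)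
  have h5 : 1 / (2 * M) * b = b / M / 2 := by field_simp
  have h6 : 0 < b / M := by positivity
  nlinarith [mul_pos hτ hsin0]

/-- Two targets that are reached at the same time share a trajectory. -/
theorem IsTransverseTarget.inter_nonempty {i j₁ j₂ : Fin T.numWalls} {z z₁ z₂ : ℝ × ℝ} {t σ : ℝ}
    {l₁ l₂ : ℂ} (hdisp : T.Dispersing) {C₁ C₂ : Set (ℝ × ℝ)} (hC₁ : C₁ ⊆ T.phase i)
    (hC₂ : C₂ ⊆ T.phase i) (h₁ : T.IsTransverseTarget i z C₁ j₁ z₁ t l₁ σ)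
    (h₂ : T.IsTransverseTarget i z C₂ j₂ z₂ t l₂ σ) : (C₁ ∩ C₂).Nonempty := by
  obtain ⟨ε, hε, hinj⟩ := hdisp.exists_injective_line h₁.collision.mem_left
  obtain ⟨M₁, hM₁, hp₁⟩ := h₁.pencil
  obtain ⟨M₂, hM₂, hp₂⟩ := h₂.pencil
  obtain ⟨δ₁, hδ₁, hp₁⟩ := hp₁ ε hε
  obtain ⟨δ₂, hδ₂, hp₂⟩ := hp₂ ε hε
  set b := min δ₁ δ₂ / 2 with hb
  have hbpos : 0 < b := by positivity
  have hle₁ := min_le_left δ₁ δ₂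
  have hle₂ := min_le_right δ₁ δ₂
  set a := b / (M₁ + M₂) with ha
  have hapos : 0 < a := by positivity
  have hMa : (M₁ + M₂) * a = b := mul_div_cancel₀ _ (by positivity)
  have hM₁a : 0 < M₁ * a := by positivity
  have hM₂a : 0 < M₂ * a := by positivity
  obtain ⟨w₁, hw₁, -, -, τ₁, s₁, -, hd₁, -, -, -, hv₁, -, -, he₁⟩ :=
    hp₁ a b hapos (by linarith) (by linarith)
  obtain ⟨w₂, hw₂, -, -, τ₂, s₂, -, hd₂, -, -, -, hv₂, -, -, he₂⟩ :=
    hp₂ a b hapos (by linarith) (by linarith)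
  have hv : T.outVel i w₁ = T.outVel i w₂ := hv₁.trans hv₂.symm
  have := hinj w₁ (hC₁ hw₁) w₂ (hC₂ hw₂) hd₁ hd₂ hv (τ₁ - s₁ - τ₂ + s₂) (by
    rw [← hv] at he₂
    push_cast
    linear_combination he₂ - he₁)
  exact ⟨w₁, hw₁, this ▸ hw₂⟩

/-- If a second target is reached later than the first one, then the lines of trajectories towards
the second one cross the wall of the first one near the time `t₁`. Before it collides, a trajectory
runs in the interior of the table, so that the crossing cannot come after its start: `s ≤ 0`. -/
theorem IsTransverseTarget.exists_crossing {i j₁ j₂ : Fin T.numWalls} {z z₁ z₂ : ℝ × ℝ}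
    {t₁ t₂ σ : ℝ} {l₁ l₂ : ℂ} (hσ : σ = 1 ∨ σ = -1) {C₁ C₂ : Set (ℝ × ℝ)}
    (h₁ : T.IsTransverseTarget i z C₁ j₁ z₁ t₁ l₁ σ)
    (h₂ : T.IsTransverseTarget i z C₂ j₂ z₂ t₂ l₂ σ) (ht : t₁ < t₂) {ε : ℝ} (hε : 0 < ε) :
    ∃ w ∈ C₂, ∃ b s : ℝ, ∃ r ∈ (T.wall j₁).interiorDom, dist w z < ε ∧ 0 < b ∧ b < ε ∧
      T.outVel i w = T.outVel i z * Complex.exp ((σ * b : ℝ) * Complex.I) ∧ |r - z₁.1| < ε ∧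
      (T.wall j₁).curve r + l₁ = (T.wall i).curve w.1 + s * T.outVel i w ∧ |s - t₁| < ε ∧ s ≤ 0 := by
  have hσa : |σ| = 1 := by rcases hσ with rfl | rfl <;> simp
  obtain ⟨C, hC, hhit⟩ := exists_hit h₁.collision.mem_right (Real.cos_pos_of_mem_Ioo h₁.transverse)
    hσ h₁.side
  obtain ⟨M, hM, hp⟩ := h₂.pencil
  set e := min ε (t₂ - t₁) / 8 with he
  have htt : 0 < t₂ - t₁ := sub_pos.2 ht
  have hepos : 0 < e := by positivity
  have he1 : 8 * e ≤ ε := by linarith [min_le_left ε (t₂ - t₁)]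
  have he2 : 8 * e ≤ t₂ - t₁ := by linarith [min_le_right ε (t₂ - t₁)]
  obtain ⟨δ₁, hδ₁, hhit⟩ := hhit e hepos
  obtain ⟨δ₂, hδ₂, hp⟩ := hp e hepos
  -- the distance at which the line passes the first target
  set f : ℝ → ℝ := fun b => b / M + (t₂ - t₁) * (Real.sin b / Real.cos b) with hf
  have hcos0 : Real.cos 0 ≠ 0 := by simp
  have hfc : ContinuousAt f 0 := by
    refine (continuousAt_id.div_const M).add (continuousAt_const.mul ?_)
    exact Real.continuous_sin.continuousAt.div Real.continuous_cos.continuousAt hcos0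
  have hf0 : f 0 = 0 := by simp [hf]
  have hgc : ContinuousAt (fun b => (t₂ - t₁) * (1 / Real.cos b - 1)) 0 :=
    continuousAt_const.mul ((continuousAt_const.div Real.continuous_cos.continuousAt hcos0).sub
      continuousAt_const)
  have hev : ∀ᶠ b in 𝓝[>] (0 : ℝ), f b < min δ₁ (ε / C) ∧
      |(t₂ - t₁) * (1 / Real.cos b - 1)| < e ∧ b < min (min δ₁ δ₂) (min 1 ε) ∧ 0 < b := by
    have h1 : ∀ᶠ b in 𝓝 (0 : ℝ), f b < min δ₁ (ε / C) :=
      hfc.eventually_lt continuousAt_const (by rw [hf0]; positivity)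
    have h2 : ∀ᶠ b in 𝓝 (0 : ℝ), |(t₂ - t₁) * (1 / Real.cos b - 1)| < e :=
      hgc.abs.eventually_lt continuousAt_const (by simpa using hepos)
    have h3 : ∀ᶠ b in 𝓝 (0 : ℝ), b < min (min δ₁ δ₂) (min 1 ε) :=
      eventually_lt_nhds (by positivity)
    filter_upwards [nhdsWithin_le_nhds h1, nhdsWithin_le_nhds h2, nhdsWithin_le_nhds h3,
      self_mem_nhdsWithin] with b h1 h2 h3 h4 using ⟨h1, h2, h3, h4⟩
  obtain ⟨b, hfb, hgb, hbm, hbpos⟩ := hev.exists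
  have hbδ₁ : b < δ₁ := hbm.trans_le ((min_le_left _ _).trans (min_le_left _ _))
  have hbδ₂ : b < δ₂ := hbm.trans_le ((min_le_left _ _).trans (min_le_right _ _))
  have hb1 : b < 1 := hbm.trans_le ((min_le_right _ _).trans (min_le_left _ _))
  have hbε : b < ε := hbm.trans_le ((min_le_right _ _).trans (min_le_right _ _))
  have hcos : 0 < Real.cos b := Real.cos_pos_of_le_one (by rw [abs_of_pos hbpos]; exact hb1.le)
  have hsin : 0 < Real.sin b := Real.sin_pos_of_pos_of_le_one hbpos hb1.le
  have hfpos : 0 < f b := by positivity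
  obtain ⟨w, hw, -, -, τ, s₂, hτ, hd, -, hτt, hs₂, hvel, hint, -, heq⟩ := hp (b / M) b
    (by positivity) hbδ₂ (by rw [mul_div_cancel₀ _ hM.ne'])
  obtain ⟨r, hr, s₁, -, hrC, hs₁, hcur⟩ := hhit (f b) (σ * b) hfpos
    (hfb.trans_le (min_le_left _ _)) (by rwa [abs_mul, hσa, one_mul, abs_of_pos hbpos])
  set m := τ - s₂ - (t₂ - t₁) / Real.cos b with hm
  have hcurve : (T.wall j₁).curve r + l₁ =
      (T.wall i).curve w.1 + ((m + s₁ : ℝ) : ℂ) * T.outVel i w := by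
    have hend := h₁.collision.endpoint
    rw [← h₁.collision.vel, ← hvel] at hcur
    have hcosC : (Real.cos b : ℂ) ≠ 0 := by exact_mod_cast hcos.ne'
    have hu : T.outVel i w = T.outVel i z *
      ((Real.cos b : ℝ) + (σ * Real.sin b : ℝ) * Complex.I) := by rw [hvel, exp_sign_mul hσ]
    have hkey : ((t₂ - t₁ : ℝ) : ℂ) * T.outVel i z =
        ((t₂ - t₁) / Real.cos b : ℝ) * T.outVel i w
        - (σ * ((t₂ - t₁) * (Real.sin b / Real.cos b)) : ℝ) * (Complex.I * T.outVel i z) := by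
      rw [hu]
      simp only [Complex.ofReal_mul, Complex.ofReal_div, Complex.ofReal_sub]
      field_simp
      ring
    have hfC : ((f b : ℝ) : ℂ) =
        ((b / M : ℝ) : ℂ) + (((t₂ - t₁) * (Real.sin b / Real.cos b) : ℝ) : ℂ) := by
      rw [← Complex.ofReal_add]
    have hmC : ((m + s₁ : ℝ) : ℂ) = τ - s₂ - ((t₂ - t₁) / Real.cos b : ℝ) + s₁ := by
      rw [hm]; push_cast; ring
    rw [hcur, hmC, hfC]
    rw [Complex.ofReal_mul] at hkey
    rw [Complex.ofReal_sub] at hkey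
    linear_combination -hend - heq - hkey
  have hmb : |(m + s₁) - t₁| < 4 * e := by
    have h1 : (m + s₁) - t₁ = (τ - t₂) - s₂ - (t₂ - t₁) * (1 / Real.cos b - 1) + s₁ := by
      rw [hm]; ring
    rw [h1, abs_lt]
    have := abs_lt.1 hτt
    have := abs_lt.1 hs₁
    have := abs_lt.1 hs₂
    have := abs_lt.1 hgb
    constructor <;> linarith
  have hmb' := abs_lt.1 hmb
  refine ⟨w, hw, b, m + s₁, r, hr, by linarith, hbpos, hbε, hvel, ?_, hcurve,
    hmb.trans (by linarith), ?_⟩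
  · refine hrC.trans_lt ?_
    have := hfb.trans_le (min_le_right _ _)
    rw [lt_div_iff₀ hC] at this
    linarith
  · by_contra hpos
    push Not at hpos
    have hτ' := abs_lt.1 hτt
    have h1 := hint (m + s₁) ⟨hpos, by linarith⟩
    rw [← hcurve] at h1
    exact wall_add_notMem_interior T (Wall.interiorDom_subset_dom _ hr) h₁.collision.mem_lattice h1

/-- A target that is reached at time zero, at a corner point, cannot be passed. By
`IsTransverseTarget.exists_crossing`, a trajectory towards a later target would start on or behind
the wall `j₁`. Turned further about its foot, its line belongs to the pencil of the first target.
The wall `j₁` being a Lipschitz graph, the turned line meets it at or before the foot as well; the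
trajectory of the pencil ends there, so it starts earlier at another nearby point of the wall `i`,
against convexity. -/
theorem IsTransverseTarget.false_of_zero {i j₁ j₂ : Fin T.numWalls} {z z₁ z₂ : ℝ × ℝ}
    {t₂ σ : ℝ} {l₁ l₂ : ℂ} (hσ : σ = 1 ∨ σ = -1) (hdisp : T.Dispersing) {C₁ C₂ : Set (ℝ × ℝ)}
    (hC₁ : C₁ ⊆ T.phase i) (hC₂ : C₂ ⊆ T.phase i)
    (hfoot : ∀ w ∈ C₂,
      σ * (((T.wall i).curve w.1 - (T.wall i).curve z.1) * conj (T.outVel i z)).im < 0)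
    (h₁ : T.IsTransverseTarget i z C₁ j₁ z₁ 0 l₁ σ)
    (h₂ : T.IsTransverseTarget i z C₂ j₂ z₂ t₂ l₂ σ) (ht : 0 < t₂) : False := by
  have hσσ : σ * σ = 1 := by rcases hσ with rfl | rfl <;> norm_num
  have hσa : |σ| = 1 := by rcases hσ with rfl | rfl <;> simp
  have hz := h₁.collision.mem_left
  obtain ⟨ε₀, hε₀, hno⟩ := hdisp.exists_no_return hz
  obtain ⟨L, hL, δL, hδL, hlip⟩ := exists_lipschitz_graph h₁.collision.mem_right
    (Real.cos_pos_of_mem_Ioo h₁.transverse)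
  obtain ⟨M, hM, hp⟩ := h₁.pencil
  obtain ⟨δ, hδ, hp⟩ := hp (min ε₀ δL) (by positivity)
  set B := min (min (δ / 2) (1 / (4 * L))) 1 with hB
  have hBpos : 0 < B := by positivity
  have hBδ : B ≤ δ / 2 := (min_le_left _ _).trans (min_le_left _ _)
  have hBL : B ≤ 1 / (4 * L) := (min_le_left _ _).trans (min_le_right _ _)
  have hB1 : B ≤ 1 := min_le_right _ _
  obtain ⟨ε₁, hε₁, hcont⟩ := Metric.continuousOn_iff.1 (T.continuousOn_curve_fst i) z hz
    (min (B / (2 * M)) (1 / (8 * M))) (by positivity)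
  obtain ⟨w, hw, b, s, r, hr, hwz, hbpos, hbB, hvel, hrz, hcurve, -, hs⟩ :=
    h₁.exists_crossing hσ h₂ ht (ε := min (min ε₀ ε₁) (min δL B)) (by positivity)
  have hwε₀ := hwz.trans_le ((min_le_left _ _).trans (min_le_left _ _))
  have hwε₁ := hwz.trans_le ((min_le_left _ _).trans (min_le_right _ _))
  have hrz' := hrz.trans_le ((min_le_right _ _).trans (min_le_left _ _))
  have hbB' := hbB.trans_le ((min_le_right _ _).trans (min_le_right _ _))
  have hdist := hcont w (hC₂ hw) hwε₁
  rw [dist_eq_norm] at hdist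
  have hf := hfoot w hw
  set v := T.outVel i z with hv
  have hvn : ‖v‖ = 1 := norm_outVel hz
  have hvv : v * conj v = 1 := mul_conj_outVel hz
  -- the coordinates of the foot of `w` along and across the trajectory of `z`
  set ζ := ((T.wall i).curve w.1 - (T.wall i).curve z.1) * conj v with hζ
  have hζn : ‖ζ‖ < min (B / (2 * M)) (1 / (8 * M)) := by
    rwa [hζ, norm_mul, Complex.norm_conj, hvn, mul_one]
  set y := ζ.re with hy
  set ξ := -(σ * ζ.im) with hξ
  have hξpos : 0 < ξ := by linarith
  have hξabs : ξ = |ζ.im| := by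
    rw [← abs_of_pos hξpos, hξ, abs_neg, abs_mul, hσa, one_mul]
  have hξB : ξ < B / (2 * M) := by
    rw [hξabs]; exact (Complex.abs_im_le_norm _).trans_lt (hζn.trans_le (min_le_left _ _))
  have hyM : |y| < 1 / (8 * M) :=
    (Complex.abs_re_le_norm _).trans_lt (hζn.trans_le (min_le_right _ _))
  have hζeq : ζ = y - (σ * ξ : ℝ) * Complex.I := by
    have h1 : σ * ξ = -ζ.im := by rw [hξ]; linear_combination (-ζ.im) * hσσ
    rw [h1]
    apply Complex.ext <;> simp [hy]
  have hA : (T.wall i).curve w.1 = (T.wall i).curve z.1 + ζ * v := by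
    rw [hζ]; linear_combination (-((T.wall i).curve w.1 - (T.wall i).curve z.1)) * hvv
  -- a turn about the foot of `w` that is large enough for the pencil of the first target
  set b' := 2 * M * ξ with hb'
  have hb'pos : 0 < b' := by positivity
  have hb'B : b' < B := by
    rw [lt_div_iff₀ (by positivity)] at hξB; linarith
  have hcos' : 1 / 2 < Real.cos b' := half_lt_cos hb'pos (by linarith)
  have hcos : 1 / 2 < Real.cos b := half_lt_cos hbpos (by linarith)
  have hsin' : Real.sin b' ≤ b' := Real.sin_le hb'pos.le
  have hsin'0 : 0 < Real.sin b' := Real.sin_pos_of_pos_of_le_one hb'pos (by linarith)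
  have hsin : Real.sin b ≤ b := Real.sin_le hbpos.le
  have hsin0 : 0 < Real.sin b := Real.sin_pos_of_pos_of_le_one hbpos (by linarith)
  have htan : |y * (Real.sin b' / Real.cos b')| ≤ ξ / 2 := by
    rw [abs_mul, abs_of_pos (div_pos hsin'0 (by linarith))]
    have h1 : Real.sin b' / Real.cos b' ≤ 4 * M * ξ := by
      rw [div_le_iff₀ (by linarith)]
      have h2 := mul_le_mul_of_nonneg_left hcos'.le (show 0 ≤ 4 * M * ξ by positivity)
      linarith
    calc |y| * (Real.sin b' / Real.cos b') ≤ 1 / (8 * M) * (4 * M * ξ) :=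
          mul_le_mul hyM.le h1 (div_pos hsin'0 (by linarith)).le (by positivity)
      _ = ξ / 2 := by field_simp; norm_num
  have htan' := abs_le.1 htan
  set a' := ξ + y * (Real.sin b' / Real.cos b') with ha'
  have hMa' : M * a' ≤ M * (3 / 2 * ξ) := mul_le_mul_of_nonneg_left (by linarith) hM.le
  obtain ⟨w₁, hw₁, w', hw', τ, s₁, hτ, hd₁, hw'z, -, -, hvel₁, -, hend, heq⟩ := hp a' b'
    (by linarith) (by linarith) (by linarith [mul_pos hM hξpos])
  set s' := s₁ - y / Real.cos b' with hs'
  -- the line of `w₁` passes through the foot of `w`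
  have hline : (T.wall i).curve w₁.1 + τ * T.outVel i w₁ =
      (T.wall i).curve w.1 + (s' : ℂ) * T.outVel i w₁ := by
    have hcosC : (Real.cos b' : ℂ) ≠ 0 := by exact_mod_cast (by linarith : Real.cos b' ≠ 0)
    have hu : T.outVel i w₁ = v *
      ((Real.cos b' : ℝ) + (σ * Real.sin b' : ℝ) * Complex.I) := by rw [hvel₁, exp_sign_mul hσ]
    have hkey : (y : ℂ) * v = (y / Real.cos b' : ℝ) * T.outVel i w₁
        - (σ * (y * (Real.sin b' / Real.cos b')) : ℝ) * (Complex.I * v) := by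
      rw [hu]
      simp only [Complex.ofReal_mul, Complex.ofReal_div]
      field_simp
      ring
    have haC : (a' : ℂ) = ξ + (y * (Real.sin b' / Real.cos b') : ℝ) := by
      rw [ha', Complex.ofReal_add]
    have hsC : (s' : ℂ) = s₁ - (y / Real.cos b' : ℝ) := by
      rw [hs', Complex.ofReal_sub]
    rw [heq, hA, hζeq, hsC, haC, Complex.ofReal_zero]
    rw [Complex.ofReal_mul σ] at hkey ⊢
    linear_combination -hkey
  -- otherwise the trajectory of `w₁` would return to the wall `i` at the foot of `w`
  have hs'pos : 0 < s' := by
    by_contra hneg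
    push Not at hneg
    refine hno w₁ (hC₁ hw₁) w (hC₂ hw) (hd₁.trans_le (min_le_left _ _)) hwε₀ (τ - s')
      (by linarith) ?_
    push_cast
    linear_combination -hline
  have hrd : r ∈ (T.wall j₁).dom := Wall.interiorDom_subset_dom _ hr
  have hL' := hlip w'.1 hw'.1 r hrd (hw'z.trans_le (min_le_right _ _)) hrz'
  rw [← h₁.collision.vel, ← hv] at hL'
  -- the displacement of the two hits, `s ≤ 0 < s'`, is nearly parallel to the trajectory of `z`
  set Δ := (T.wall j₁).curve w'.1 - (T.wall j₁).curve r with hΔ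
  have hΔv : Δ * conj v = s' * ((Real.cos b' : ℝ) + (σ * Real.sin b' : ℝ) * Complex.I) -
      s * ((Real.cos b : ℝ) + (σ * Real.sin b : ℝ) * Complex.I) := by
    rw [← exp_sign_mul hσ, ← exp_sign_mul hσ]
    have h1 : Δ = s' * T.outVel i w₁ - s * T.outVel i w := by
      rw [hΔ]; linear_combination hline - hend - hcurve
    rw [h1, hvel₁, hvel]
    linear_combination (s' * Complex.exp ((σ * b' : ℝ) * Complex.I) -
      s * Complex.exp ((σ * b : ℝ) * Complex.I)) * hvv
  have hre : (Δ * conj v).re = s' * Real.cos b' - s * Real.cos b := by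
    rw [hΔv, Complex.sub_re, Complex.re_ofReal_mul, Complex.re_ofReal_mul, Complex.add_re,
      Complex.add_re, Complex.re_ofReal_mul, Complex.re_ofReal_mul, Complex.ofReal_re,
      Complex.ofReal_re, Complex.I_re, mul_zero, mul_zero, add_zero, add_zero]
  have him : (Δ * conj v).im = σ * (s' * Real.sin b' - s * Real.sin b) := by
    rw [hΔv, Complex.sub_im, Complex.im_ofReal_mul, Complex.im_ofReal_mul, Complex.add_im,
      Complex.add_im, Complex.im_ofReal_mul, Complex.im_ofReal_mul, Complex.ofReal_im,
      Complex.ofReal_im, Complex.I_im]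
    ring
  have hlow : (s' - s) / 2 < ‖Δ‖ := by
    have h1 := Complex.re_le_norm (Δ * conj v)
    rw [hre, norm_mul, Complex.norm_conj, hvn, mul_one] at h1
    have h2 := mul_lt_mul_of_pos_left hcos' hs'pos
    have h3 := mul_le_mul_of_nonneg_left hcos.le (neg_nonneg.2 hs)
    linarith
  have hup : |(Δ * conj v).im| ≤ (s' - s) * B := by
    have h1 := mul_le_mul_of_nonneg_left (hsin'.trans hb'B.le) hs'pos.le
    have h2 := mul_le_mul_of_nonneg_left (hsin.trans hbB'.le) (neg_nonneg.2 hs)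
    have h3 := mul_pos hs'pos hsin'0
    have h4 := mul_nonneg (neg_nonneg.2 hs) hsin0.le
    rw [him, abs_mul, hσa, one_mul, abs_of_nonneg (by linarith)]
    linarith
  have hLB : L * B ≤ 1 / 4 := by
    rw [le_div_iff₀ (by positivity)] at hBL; linarith
  have h1 : L * |(Δ * conj v).im| ≤ L * ((s' - s) * B) := by gcongr
  have h2 := mul_le_mul_of_nonneg_left hLB (show 0 ≤ s' - s by linarith)
  linarith

end Table

/-! ### Uniqueness of the sector -/

namespace Table

variable {T : Table}

theorem IsTransverseTarget.inter_nonempty_of_le {i j₁ j₂ : Fin T.numWalls} {z z₁ z₂ : ℝ × ℝ}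
    {t₁ t₂ σ : ℝ} {l₁ l₂ : ℂ} (hσ : σ = 1 ∨ σ = -1) (hdisp : T.Dispersing) {C₁ C₂ : Set (ℝ × ℝ)}
    (hC₁ : C₁ ⊆ T.phase i) (hC₂ : C₂ ⊆ T.phase i)
    (hfoot : ∀ w ∈ C₂,
      σ * (((T.wall i).curve w.1 - (T.wall i).curve z.1) * conj (T.outVel i z)).im < 0)
    (h₁ : T.IsTransverseTarget i z C₁ j₁ z₁ t₁ l₁ σ)
    (h₂ : T.IsTransverseTarget i z C₂ j₂ z₂ t₂ l₂ σ) (ht : t₁ ≤ t₂) : (C₁ ∩ C₂).Nonempty := by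
  rcases ht.eq_or_lt with rfl | hlt
  · exact h₁.inter_nonempty hdisp hC₁ hC₂ h₂
  · rcases h₁.collision.nonneg.eq_or_lt with h0 | h0
    · subst h0
      exact (h₁.false_of_zero hσ hdisp hC₁ hC₂ hfoot h₂ hlt).elim
    · obtain ⟨w, -, b, s, r, -, -, -, -, -, -, -, h1, h2⟩ := h₁.exists_crossing hσ h₂ hlt h0
      linarith [(abs_lt.1 h1).1]

theorem IsSector.subset {i : Fin T.numWalls} {z : ℝ × ℝ} {ρ : ℝ} {q : Quadrant}
    {C : Set (ℝ × ℝ)} (h : T.IsSector i z ρ q C) : C ⊆ T.quadrant i z ρ q := by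
  obtain ⟨⟨w, -, rfl⟩, -⟩ := h
  exact (connectedComponentIn_subset _ _).trans sdiff_subset

theorem IsSector.eq_of_inter_nonempty {i : Fin T.numWalls} {z : ℝ × ℝ} {ρ : ℝ} {q : Quadrant}
    {C₁ C₂ : Set (ℝ × ℝ)} (h₁ : T.IsSector i z ρ q C₁) (h₂ : T.IsSector i z ρ q C₂)
    (h : (C₁ ∩ C₂).Nonempty) : C₁ = C₂ := by
  obtain ⟨⟨w₁, -, rfl⟩, -⟩ := h₁
  obtain ⟨⟨w₂, -, rfl⟩, -⟩ := h₂
  obtain ⟨w, hw₁, hw₂⟩ := h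
  rw [connectedComponentIn_eq hw₁, connectedComponentIn_eq hw₂]

end Table

end Billiard

theorem mainTheorem4 (T : Billiard.Table) (hdisp : T.Dispersing) (hA0 : T.SimpleCorners)
    (hA1 : T.NoCusps) (hA2 : T.BoundedHorizon) (k₀ : ℕ) (hk₀ : 1 ≤ k₀)
    (i : Fin T.numWalls) (z : ℝ × ℝ) (hz : z ∈ T.phase i) :
    ∃ ρ₀ : ℝ, 0 < ρ₀ ∧ ∀ ρ : ℝ, 0 < ρ → ρ < ρ₀ → ∀ Q : Billiard.Quadrant, Q.IsActive →
      {C : Set (ℝ × ℝ) | ∃ (j : Fin T.numWalls) (z' : ℝ × ℝ),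
        T.IsRegularSector k₀ i z ρ Q C j z' ∧
        T.ContainsActiveQuadrant j z' (T.image i C j)}.Subsingleton := by
  obtain ⟨ρ₁, hρ₁, hloc⟩ := Billiard.Table.exists_localization hdisp hA2 hz
  obtain ⟨ρ₂, hρ₂, hf₂⟩ := hdisp.exists_foot_side hz (Or.inl (rfl : (1 : ℝ) = 1))
  obtain ⟨ρ₃, hρ₃, hf₃⟩ := hdisp.exists_foot_side hz (Or.inr (rfl : (-1 : ℝ) = -1))
  refine ⟨min ρ₁ (min ρ₂ ρ₃), by positivity, fun ρ hρ hρlt Q hQ => ?_⟩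
  obtain ⟨σ, hσ, hQσ⟩ := hQ.exists_sign
  have hfoot : ∀ w ∈ T.quadrant i z ρ Q, σ * (((T.wall i).curve w.1 - (T.wall i).curve z.1) *
      (starRingEnd ℂ) (T.outVel i z)).im < 0 := fun w hw => by
    have hd := (Billiard.Table.dist_lt_of_mem_quadrant hρ hw).trans hρlt
    have hc := (hQσ _ _).1 hw.2.2.2
    rcases hσ with rfl | rfl
    · exact hf₂ w hw.1 (hd.trans_le ((min_le_right _ _).trans (min_le_left _ _))) hc.1 hc.2
    · exact hf₃ w hw.1 (hd.trans_le ((min_le_right _ _).trans (min_le_right _ _))) hc.1 hc.2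
  have htarget : ∀ (C : Set (ℝ × ℝ)) (j : Fin T.numWalls) (z' : ℝ × ℝ),
      T.IsRegularSector k₀ i z ρ Q C j z' → T.ContainsActiveQuadrant j z' (T.image i C j) →
      ∃ t l, T.IsTransverseTarget i z C j z' t l σ := by
    rintro C j z' ⟨hsec, hcen, hreg⟩ ⟨q, hq, ρ', hρ', hne, hsub⟩
    obtain ⟨t, l, hcol⟩ := hcen.exists_closedCollision hA2 hsec.2
    obtain ⟨σ', hσ', hqσ⟩ := hq.exists_sign
    have hCρ : ∀ w ∈ C, dist w z < ρ₁ := fun w hw =>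
      ((Billiard.Table.dist_lt_of_mem_quadrant hρ (hsec.subset hw)).trans hρlt).trans_le
        (min_le_left _ _)
    have key := Billiard.Table.exists_isTransverseTarget (σ := -σ')
      (by rcases hσ' with rfl | rfl <;> simp) hCρ hcol (hloc j z' t l hcol)
      (Billiard.regularAngles_subset hk₀ hreg) (q := q)
      (fun x y => by rw [hqσ]; constructor <;> rintro ⟨h1, h2⟩ <;> constructor <;> linarith)
      hρ' hne hsub
    have hcases : σ' = σ ∨ -σ' = σ := by
      rcases hσ with rfl | rfl <;> rcases hσ' with rfl | rfl <;> simp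
    rcases hcases with rfl | rfl
    · exact (key.false_of_neg hσ fun w hw => hfoot w (hsec.subset hw)).elim
    · exact ⟨t, l, key⟩
  rintro C₁ ⟨j₁, z₁, hr₁, hc₁⟩ C₂ ⟨j₂, z₂, hr₂, hc₂⟩
  obtain ⟨t₁, l₁, h₁⟩ := htarget C₁ j₁ z₁ hr₁ hc₁
  obtain ⟨t₂, l₂, h₂⟩ := htarget C₂ j₂ z₂ hr₂ hc₂
  have hs₁ := hr₁.1.subset
  have hs₂ := hr₂.1.subset
  rcases le_total t₁ t₂ with ht | ht
  · exact hr₁.1.eq_of_inter_nonempty hr₂.1 (h₁.inter_nonempty_of_le hσ hdisp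
      (fun w hw => (hs₁ hw).1) (fun w hw => (hs₂ hw).1) (fun w hw => hfoot w (hs₂ hw)) h₂ ht)
  · exact (hr₂.1.eq_of_inter_nonempty hr₁.1 (h₂.inter_nonempty_of_le hσ hdisp
      (fun w hw => (hs₂ hw).1) (fun w hw => (hs₁ hw).1) (fun w hw => hfoot w (hs₁ hw)) h₁ ht)).symm
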